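/- **Setting.** Let $1\le K\le L$, and let $\{\mathbf g_i\}\subset\mathbb C^{K}$ (desired) and $\{\mathbf y_i\}\subset\mathbb C^{L}$ (observed) be zero-mean, square-integrable random vectors with $E\{\mathbf g_i\mathbf g_j^H\}=\rho[i-j]\,\mathbf C_g$ and $E\{\mathbf y_i\mathbf y_j^H\}=\rho[i-j]\,\mathbf C_y$, where $\mathbf C_y$ is positive definite, such that the MMSE estimate of $\mathbf g_i$ from the observations is $\boldsymbol\Gamma\mathbf y_i$ for a fixed matrix $\boldsymbol\Gamma\in\mathbb C^{K\times L}$, $\boldsymbol\Gamma\ne 0$. Assume the samples are uncorrelated, $\rho[\tau]=\delta_\tau$. For $N$ samples put $\underline{\mathbf y}=\mathrm{vec}([\mathbf y_1,\dots,\mathbf y_N]^T)$ and $\underline{\mathbf g}=\mathrm{vec}([\mathbf g_1,\dots,\mathbf g_N]^T)$. A hardware-limited system uses $P=P_q N$ complex ADCs ($1\le P_q\le L$, zero remainder $P_r=0$), so that the analog combining ratio is $r=P/(NL)=P_q/L$. It consists of an analog combining matrix $\mathbf A\in\mathbb C^{P\times NL}$, identical dithered scalar uniform quantizers with $\tilde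 M=\lfloor 2^{R/(2r)}\rfloor$ levels ($R$ the overall rate) applied to the real and imaginary parts of the entries of $\mathbf A\underline{\mathbf y}$, with output $\mathbf q\in\mathbb C^P$, and a digital processing matrix $\mathbf B\in\mathbb C^{NK\times P}$ giving the estimate $\mathbf B\mathbf q$ of $\underline{\mathbf g}$. The support $\gamma$ is $\eta$ times the largest standard deviation of the (dithered) quantizer inputs, $0<\eta<\sqrt{3/2}\,\tilde M$, i.e. $\gamma^2=\kappa\max_l E\{|(\mathbf A\underline{\mathbf y})_l|^2\}$ with $\kappa=\eta^2\bigl(1-\tfrac{2\eta^2}{3\tilde M^2}\bigr)^{-1}$. The quantizers are taken to operate within their support in the usual sense: $\mathbf q-\mathbf A\underline{\mathbf y}$ is zero-mean white noise with power $\frac{4\gamma^2}{3\tilde M^2}$ per complex entry, uncorrelated with $\underline{\mathbf y}$ and $\underline{\mathbf g}$. (This holds for uniform quantizers with spacing $\Delta=2\gamma/\tilde M$ and i.i.d. dither with i.i.d. real and imaginary parts uniform on $[-\Delta/2,\Delta/2]$, independent of $(\underline{\mathbf y},\underline{\mathbf g})$, whenever they are almost surely not overloaded and the error of each ADC has the nominal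 power $\frac{4\gamma^2}{3\tilde M^2}$.) The average MSE is $\frac1{NK}E\{\|\underline{\mathbf g}-\mathbf B\mathbf q\|^2\}$, in the limit $N\to\infty$. Let $\tilde{\boldsymbol\Gamma}=\boldsymbol\Gamma\mathbf C_y^{1/2}$ have singular values $\sigma_1\ge\sigma_2\ge\cdots$ (continued by $0$), and let $\varphi(\alpha)=(\alpha-1)^+$. **Claim.** There is a unique $\zeta$ with $$\frac{4\kappa}{3\tilde M^2P_q}\sum_{i=1}^{P_q}\varphi(\zeta\sigma_i)=1 .$$ With this $\zeta$, there exist, and let be chosen arbitrarily: a right singular vectors matrix $\mathbf V\in\mathbb C^{L\times L}$ of $\tilde{\boldsymbol\Gamma}$; a diagonal $\boldsymbol\Lambda\in\mathbb C^{P_q\times L}$ with $\boldsymbol\Lambda_{i,i}^2=\frac{4\kappa}{3\tilde M^2\, r}\varphi(\zeta\sigma_i)$; and a unitary $\mathbf U\in\mathbb C^{P_q\times P_q}$ for which $\mathbf U\boldsymbol\Lambda\boldsymbol\Lambda^H\mathbf U^H$ has identical diagonal entries. Put $$\mathbf A'_o=\mathbf U\boldsymbol\Lambda\mathbf V^H\mathbf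 C_y^{-1/2},\qquad \mathbf B'_o=\tilde{\boldsymbol\Gamma}\mathbf V\boldsymbol\Lambda^H\Bigl(\boldsymbol\Lambda\boldsymbol\Lambda^H+\tfrac{4\gamma^2}{3\tilde M^2}\mathbf I\Bigr)^{-1}\mathbf U^H,\qquad \gamma^2=\frac{\kappa}{r}.$$ Then the system that applies $\mathbf A'_o$, the ADCs and $\mathbf B'_o$ to each $\mathbf y_i$ separately, i.e. $\mathbf A=\mathbf A'_o\otimes\mathbf I_N$ and $\mathbf B=\mathbf B'_o\otimes\mathbf I_N$, has support $\gamma^2=\kappa/r$ and minimizes the average MSE among all hardware-limited systems, for every $N\ge1$ and in the limit $N\to\infty$. The minimal average MSE is $$\mu^{\rm HL}=\frac1K\mathrm{Tr}\bigl(\mathbf C_g-\boldsymbol\Gamma\mathbf C_y\boldsymbol\Gamma^H\bigr)+\frac1K\sum_{i=1}^{\min(K,P_q)}\frac{\sigma_i^2}{\varphi(\zeta\sigma_i)+1}+\frac{\delta_{(P_q<K)}}{K}\sum_{i=P_q+1}^{K}\sigma_i^2 .$$ -/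

import Mathlib

open scoped Matrix Kronecker MatrixOrder ComplexOrder
open MeasureTheory ProbabilityTheory Filter Topology

namespace TaskQuant

noncomputable section

variable {Ω : Type*} [MeasurableSpace Ω]

/-! ### The source model -/

/-- The vector obtained by stacking the first `N` samples `x 0, …, x (N - 1)` of a sequence of
random vectors in `ℂⁿ`; the entry `(l, i)` is the `l`-th entry of the `i`-th sample, so that
a covariance matrix that factors over the samples is a Kronecker product. -/
def stack {n : ℕ} (x : ℕ → Ω → Fin n → ℂ) (N : ℕ) (ω : Ω) : Fin n × Fin N → ℂ :=
  fun p => x p.2 ω p.1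

/-- Desired signal `g`, observations `y`: zero-mean, square-integrable, with autocorrelations
`E[g_i g_jᴴ] = ρ[i - j] C_g` and `E[y_i y_jᴴ] = ρ[i - j] C_y`, and such that the MMSE estimate
(the conditional expectation) of each `g_i` from the observations is `Γ y_i`. -/
structure IsSource {K L : ℕ} (P : Measure Ω) (ρ : ℤ → ℝ)
    (Cg : Matrix (Fin K) (Fin K) ℂ) (Cy : Matrix (Fin L) (Fin L) ℂ)
    (Γ : Matrix (Fin K) (Fin L) ℂ)
    (g : ℕ → Ω → Fin K → ℂ) (y : ℕ → Ω → Fin L → ℂ) : Prop where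
  measurable_g : ∀ i, Measurable (g i)
  measurable_y : ∀ i, Measurable (y i)
  memLp_g : ∀ i k, MemLp (fun ω => g i ω k) 2 P
  memLp_y : ∀ i l, MemLp (fun ω => y i ω l) 2 P
  mean_g : ∀ i k, ∫ ω, g i ω k ∂P = 0
  mean_y : ∀ i l, ∫ ω, y i ω l ∂P = 0
  corr_g : ∀ (i j : ℕ) (k k' : Fin K),
    ∫ ω, g i ω k * star (g j ω k') ∂P = Cg k k' * (ρ ((i : ℤ) - (j : ℤ)) : ℂ)
  corr_y : ∀ (i j : ℕ) (l l' : Fin L),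
    ∫ ω, y i ω l * star (y j ω l') ∂P = Cy l l' * (ρ ((i : ℤ) - (j : ℤ)) : ℂ)
  mmse : ∀ (N : ℕ) (i : Fin N) (k : Fin K),
    P[fun ω => g i ω k | MeasurableSpace.comap (stack y N) inferInstance]
      =ᵐ[P] fun ω => (Γ *ᵥ y i ω) k

/-! ### The analog-to-digital converters -/

/-- The uniform scalar quantizer with `M` levels, support `γ` and spacing `Δ = 2 γ / M`: on the
cell `[-γ + l Δ, -γ + (l + 1) Δ]` the output is `-γ + Δ (l + 1/2)`, `l = 0, …, M - 1`, and outside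
the support it is `sign(x) (γ - Δ / 2)`. -/
def uniformQuantizer (M : ℕ) (γ x : ℝ) : ℝ :=
  if γ < |x| then SignType.sign x * (γ - (2 * γ / M) / 2)
  else -γ + (2 * γ / M) * ((min ⌊(x + γ) / (2 * γ / M)⌋₊ (M - 1) : ℕ) + 1 / 2)

/-- The dither: the real and imaginary parts of all `z l` are independent, uniform over
`[-Δ/2, Δ/2]` with `Δ = 2 γ / M`, and the dither is independent of the signals `w`. -/
structure IsDither {ι W : Type*} [MeasurableSpace W] (P : Measure Ω) (M : ℕ) (γ : ℝ)
    (w : Ω → W) (z : Ω → ι → ℂ) : Prop where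
  measurable : ∀ l, Measurable (fun ω => z ω l)
  uniform_re : ∀ l, pdf.IsUniform (fun ω => (z ω l).re) (Set.Icc (-(γ / M)) (γ / M)) P volume
  uniform_im : ∀ l, pdf.IsUniform (fun ω => (z ω l).im) (Set.Icc (-(γ / M)) (γ / M)) P volume
  indep : iIndepFun
    (fun (a : ι × Bool) (ω : Ω) => if a.2 then (z ω a.1).re else (z ω a.1).im) P
  indep_signal : IndepFun z w P

/-- Output of identical dithered quantizers, applied to the real and imaginary parts of each entry
of the input `s` with dither `z`. -/
def ditheredOutput {ι : Type*} (M : ℕ) (γ : ℝ) (s z : Ω → ι → ℂ) (ω : Ω) (l : ι) : ℂ :=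
  (uniformQuantizer M γ (s ω l + z ω l).re : ℂ) +
    Complex.I * (uniformQuantizer M γ (s ω l + z ω l).im : ℂ)

/-- The nominal power `4 γ² / (3 M²)` of the (complex) error of a dithered quantizer with `M` levels
per real dimension, given the squared support `γ²`: `Δ² / 6` per real dimension. -/
def noisePower (M : ℕ) (γsq : ℝ) : ℝ := 4 * γsq / (3 * (M : ℝ) ^ 2)

/-- `q` is the input `s` plus zero-mean white noise of power `σsq`, uncorrelated with the
observations `Y` and the desired signal `G`. -/
structure IsAdditiveWhite {ι α β : Type*} [DecidableEq ι] (P : Measure Ω) (σsq : ℝ)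
    (Y : Ω → α → ℂ) (G : Ω → β → ℂ) (s q : Ω → ι → ℂ) : Prop where
  memLp : ∀ l, MemLp (fun ω => q ω l - s ω l) 2 P
  mean : ∀ l, ∫ ω, (q ω l - s ω l) ∂P = 0
  uncorr_obs : ∀ l a, ∫ ω, (q ω l - s ω l) * star (Y ω a) ∂P = 0
  uncorr_des : ∀ l b, ∫ ω, (q ω l - s ω l) * star (G ω b) ∂P = 0
  white : ∀ l l', ∫ ω, (q ω l - s ω l) * star (q ω l' - s ω l') ∂P =
    if l = l' then (σsq : ℂ) else 0

/-- The real and imaginary parts of the (dithered) inputs of the quantizers stay in the support. -/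
def NoOverload {ι : Type*} (P : Measure Ω) (γ : ℝ) (s z : Ω → ι → ℂ) : Prop :=
  ∀ᵐ ω ∂P, ∀ l, |(s ω l + z ω l).re| ≤ γ ∧ |(s ω l + z ω l).im| ≤ γ

/-! ### Hardware-limited systems -/

/-- Analog combining ratio `r` for `p` quantizers per observed sample of size `L`. -/
def ratio (p L : ℕ) : ℝ := (p : ℝ) / L

/-- Resolution `⌊2 ^ (R / (2 r))⌋` of each scalar quantizer at overall rate `R`. -/
def resolution (R r : ℝ) : ℕ := ⌊(2 : ℝ) ^ (R / (2 * r))⌋₊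

/-- `κ = η² (1 - 2 η² / (3 M²))⁻¹`. -/
def kappa (η : ℝ) (M : ℕ) : ℝ := η ^ 2 * (1 - 2 * η ^ 2 / (3 * (M : ℝ) ^ 2))⁻¹

/-- Output of the analog combining matrix `A` on the first `N` observed samples. -/
def analogOutput {ι : Type*} {L : ℕ} (y : ℕ → Ω → Fin L → ℂ) (N : ℕ)
    (A : Matrix ι (Fin L × Fin N) ℂ) (ω : Ω) : ι → ℂ :=
  A *ᵥ stack y N ω

/-- Squared support of the quantizers: `γ² = κ max_l E |(A y)_l|²`. This is the rule "`γ` is `η` times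
the largest standard deviation of the quantizer inputs": the dither adds `2 γ² / (3 M²)` to each
variance, and `γ² = η² (max_l E |(A y)_l|² + 2 γ² / (3 M²))` is solved by this `γ²`. -/
def supportSq {ι : Type*} {L : ℕ} (P : Measure Ω) (κ : ℝ) (y : ℕ → Ω → Fin L → ℂ) (N : ℕ)
    (A : Matrix ι (Fin L × Fin N) ℂ) : ℝ :=
  κ * ⨆ l, ∫ ω, ‖analogOutput y N A ω l‖ ^ 2 ∂P

/-- `q` is a possible output of the ADC array of the system with analog combining `A`: with the
support fixed by `A`, the ADCs act as dithered quantizers inside their support do, adding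
uncorrelated white noise of the nominal power to their inputs. -/
def IsADCOutput {ι : Type*} [DecidableEq ι] {K L : ℕ} (P : Measure Ω) (κ : ℝ) (M : ℕ)
    (g : ℕ → Ω → Fin K → ℂ) (y : ℕ → Ω → Fin L → ℂ) (N : ℕ)
    (A : Matrix ι (Fin L × Fin N) ℂ) (q : Ω → ι → ℂ) : Prop :=
  IsAdditiveWhite P (noisePower M (supportSq P κ y N A)) (stack y N) (stack g N)
    (analogOutput y N A) q

/-- Average MSE `E ‖g - B q‖² / (N K)` of the recovery of the first `N` samples of `g` from the
ADC output `q` by the digital processing matrix `B`. -/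
def avgMSE {ι : Type*} [Fintype ι] {K : ℕ} (P : Measure Ω) (g : ℕ → Ω → Fin K → ℂ) (N : ℕ)
    (B : Matrix (Fin K × Fin N) ι ℂ) (q : Ω → ι → ℂ) : ℝ :=
  (∫ ω, ∑ k, ‖stack g N ω k - (B *ᵥ q ω) k‖ ^ 2 ∂P) / (N * K)

/-- The matrix that applies the same matrix `A` to each of the `N` samples separately. -/
def perSample {m n : ℕ} (A : Matrix (Fin m) (Fin n) ℂ) (N : ℕ) :
    Matrix (Fin m × Fin N) (Fin n × Fin N) ℂ :=
  A ⊗ₖ (1 : Matrix (Fin N) (Fin N) ℂ)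

/-! ### The explicit design -/

/-- `Γ̃ = Γ C_y^{1/2}`. -/
def gammaTilde {K L : ℕ} (Γ : Matrix (Fin K) (Fin L) ℂ) (Cy : Matrix (Fin L) (Fin L) ℂ) :
    Matrix (Fin K) (Fin L) ℂ :=
  Γ * CFC.sqrt Cy

/-- The singular values of a matrix in descending order (indexed from `0`, and continued by `0`). -/
def singVal {K L : ℕ} (G : Matrix (Fin K) (Fin L) ℂ) (i : ℕ) : ℝ :=
  (Matrix.toEuclideanLin G).singularValues i

/-- The rectangular diagonal matrix of the singular values. -/
def singMatrix {K L : ℕ} (G : Matrix (Fin K) (Fin L) ℂ) : Matrix (Fin K) (Fin L) ℂ :=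
  Matrix.of fun i j => if (i : ℕ) = (j : ℕ) then (singVal G i : ℂ) else 0

/-- `V` is the matrix of the right singular vectors in a singular value decomposition of `G`. -/
def IsRightSingular {K L : ℕ} (G : Matrix (Fin K) (Fin L) ℂ) (V : Matrix (Fin L) (Fin L) ℂ) :
    Prop :=
  V ∈ Matrix.unitaryGroup (Fin L) ℂ ∧
    ∃ W ∈ Matrix.unitaryGroup (Fin K) ℂ, G = W * singMatrix G * Vᴴ

/-- `φ(α) = (α - 1)⁺`. -/
def phi (α : ℝ) : ℝ := max (α - 1) 0

/-- The water-filling condition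
`4 κ / (3 M² p) ∑_{i ≤ p} φ(ζ σ_i) = 1`, with `σ_i` the singular values of `G`. -/
def WaterFilling {K L : ℕ} (G : Matrix (Fin K) (Fin L) ℂ) (p : ℕ) (κ : ℝ) (M : ℕ) (ζ : ℝ) : Prop :=
  4 * κ / (3 * (M : ℝ) ^ 2 * p) * ∑ i ∈ Finset.range p, phi (ζ * singVal G i) = 1

/-- The factors `U`, `Λ`, `V` of the analog combining: `V` holds the right singular vectors of `G`,
`Λ` is diagonal with `Λ_{i,i}² = 4 κ φ(ζ σ_i) / (3 M² r)`, and `U` is a unitary matrix for which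
`U Λ Λᴴ Uᴴ` has identical diagonal entries. -/
structure IsDesign {K L p : ℕ} (G : Matrix (Fin K) (Fin L) ℂ) (κ : ℝ) (M : ℕ) (r ζ : ℝ)
    (U : Matrix (Fin p) (Fin p) ℂ) (Λ : Matrix (Fin p) (Fin L) ℂ)
    (V : Matrix (Fin L) (Fin L) ℂ) : Prop where
  right_singular : IsRightSingular G V
  off_diag : ∀ (i : Fin p) (j : Fin L), (i : ℕ) ≠ (j : ℕ) → Λ i j = 0
  diag : ∀ (i : Fin p) (j : Fin L), (i : ℕ) = (j : ℕ) →
    Λ i j ^ 2 = ((4 * κ / (3 * (M : ℝ) ^ 2 * r) * phi (ζ * singVal G i) : ℝ) : ℂ)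
  unitary : U ∈ Matrix.unitaryGroup (Fin p) ℂ
  equal_diag : ∀ i j, (U * Λ * Λᴴ * Uᴴ) i i = (U * Λ * Λᴴ * Uᴴ) j j

/-- The per-sample analog combining matrix `U Λ Vᴴ C_y^{-1/2}`. -/
def analogMatrix {L p : ℕ} (Cy : Matrix (Fin L) (Fin L) ℂ) (U : Matrix (Fin p) (Fin p) ℂ)
    (Λ : Matrix (Fin p) (Fin L) ℂ) (V : Matrix (Fin L) (Fin L) ℂ) : Matrix (Fin p) (Fin L) ℂ :=
  U * Λ * Vᴴ * (CFC.sqrt Cy)⁻¹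

/-- The per-sample digital processing matrix
`G V Λᴴ (Λ Λᴴ + 4 γ² / (3 M²) I)⁻¹ Uᴴ`. -/
def digitalMatrix {K L p : ℕ} (G : Matrix (Fin K) (Fin L) ℂ) (M : ℕ) (γsq : ℝ)
    (U : Matrix (Fin p) (Fin p) ℂ) (Λ : Matrix (Fin p) (Fin L) ℂ)
    (V : Matrix (Fin L) (Fin L) ℂ) : Matrix (Fin K) (Fin p) ℂ :=
  G * V * Λᴴ * (Λ * Λᴴ + (noisePower M γsq : ℂ) • (1 : Matrix (Fin p) (Fin p) ℂ))⁻¹ * Uᴴ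

/-- The average MMSE without quantization, `Tr(C_g - Γ C_y Γᴴ) / K`. -/
def mmseValue {K L : ℕ} (Cg : Matrix (Fin K) (Fin K) ℂ) (Cy : Matrix (Fin L) (Fin L) ℂ)
    (Γ : Matrix (Fin K) (Fin L) ℂ) : ℝ :=
  (1 / (K : ℝ)) * (Matrix.trace (Cg - Γ * Cy * Γᴴ)).re

/-- The optimal average MSE: the MMSE plus
`(1/K) ∑_{i ≤ min(K, p)} σ_i² / (φ(ζ σ_i) + 1)` plus, if `p < K`, `(1/K) ∑_{p < i ≤ K} σ_i²`. -/
def optimalValue {K L : ℕ} (Cg : Matrix (Fin K) (Fin K) ℂ) (Cy : Matrix (Fin L) (Fin L) ℂ)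
    (Γ : Matrix (Fin K) (Fin L) ℂ) (p : ℕ) (ζ : ℝ) : ℝ :=
  mmseValue Cg Cy Γ
    + (1 / (K : ℝ)) * ∑ i ∈ Finset.range (min K p),
        singVal (gammaTilde Γ Cy) i ^ 2 / (phi (ζ * singVal (gammaTilde Γ Cy) i) + 1)
    + (1 / (K : ℝ)) * ∑ i ∈ Finset.Ico p K, singVal (gammaTilde Γ Cy) i ^ 2

end

end TaskQuant

/-! Let `e` be the quantization noise, `A' = A (C_y^{1/2} ⊗ I)`, and `c = 4κ/(3M²)`. The error
splits as `g - B q = (g - Γ y) + (Γ - B A) y - B e`, with `Γ` acting on each sample. The three terms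
are orthogonal: the first by the MMSE property, the last because the noise is uncorrelated with the
signals. So `N K` times the excess of the average MSE over the MMSE equals `‖Γ̃ ⊗ I - B A'‖² + c s
‖B‖²` in Frobenius norms, where `s` is the largest squared row norm of `A'` (`avgMSE_eq`).

Lower bound (`waterCost_le`). A maximum is at least the mean over the `pN` rows, so `s ≥
‖A'‖²/(pN)`. Completing a square then gives, for every `τ ≥ 0`, `c s ‖B‖² ≥ 2τ ‖A'‖‖B‖ - τ² pN/c`.
Since `‖A'‖‖B‖` dominates the nuclear norm of `X = B A'`, what remains is to approximate `Γ̃ ⊗ I` by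
a matrix of rank at most `pN` under a nuclear-norm penalty. Its optimum soft-thresholds the `pN`
largest singular values at `τ` (`frobSq_diagonal_sub_mul_ge`). With `τ = 1/ζ` the water-filling
equation turns the bound into `N` times the claimed cost (`waterCost_eq_soft_threshold`).

Attainment (`IsDesign.sum_norm_sq_row`, `IsDesign.cost_eq`). The unitary `U` equalizes the row
norms, so maximum and mean agree. In singular coordinates the design is diagonal and each direction
can be evaluated separately. Bound and attained value do not depend on `N`, hence they pass to the
limit.

Separately, `isAdditiveWhite_ditheredOutput` shows that dithered quantizers without overload and
with the nominal error power satisfy the noise model: uniform dither covers exactly one quantization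
cell, so the error averages to zero given everything independent of that dither. -/

namespace TaskQuant

/-! ### The squared Frobenius norm -/

section Frobenius

variable {m n : Type*} [Fintype m] [Fintype n]

/-- The squared Frobenius norm of a matrix. -/
noncomputable def frobSq (A : Matrix m n ℂ) : ℝ := ∑ i, ∑ j, ‖A i j‖ ^ 2

lemma frobSq_nonneg (A : Matrix m n ℂ) : 0 ≤ frobSq A := by
  unfold frobSq; positivity

lemma mul_conjTranspose_apply_self {m n : Type*} [Fintype n] (A : Matrix m n ℂ) (i : m) :
    (A * Aᴴ) i i = ((∑ j, ‖A i j‖ ^ 2 : ℝ) : ℂ) := by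
  rw [Matrix.mul_apply]
  push_cast
  refine Finset.sum_congr rfl fun j _ => ?_
  rw [Matrix.conjTranspose_apply, Complex.star_def, Complex.mul_conj, Complex.normSq_eq_norm_sq]
  push_cast; rfl

lemma trace_mul_conjTranspose (A : Matrix m n ℂ) : (A * Aᴴ).trace = (frobSq A : ℂ) := by
  simp only [Matrix.trace, Matrix.diag_apply, mul_conjTranspose_apply_self, frobSq]
  push_cast; rfl

lemma frobSq_conjTranspose (A : Matrix m n ℂ) : frobSq Aᴴ = frobSq A := by
  unfold frobSq
  rw [Finset.sum_comm]
  simp [Matrix.conjTranspose_apply]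

lemma frobSq_mul_unitary [DecidableEq n] (A : Matrix m n ℂ) {V : Matrix n n ℂ}
    (hV : V ∈ Matrix.unitaryGroup n ℂ) : frobSq (A * V) = frobSq A := by
  have h : V * Vᴴ = 1 := Matrix.mem_unitaryGroup_iff.mp hV
  have : ((frobSq (A * V) : ℝ) : ℂ) = frobSq A := by
    rw [← trace_mul_conjTranspose, ← trace_mul_conjTranspose, Matrix.conjTranspose_mul,
      Matrix.mul_assoc, ← Matrix.mul_assoc V, h, Matrix.one_mul]
  exact_mod_cast this

lemma conjTranspose_mem_unitaryGroup [DecidableEq n] {V : Matrix n n ℂ}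
    (hV : V ∈ Matrix.unitaryGroup n ℂ) : Vᴴ ∈ Matrix.unitaryGroup n ℂ :=
  Unitary.star_mem hV

lemma frobSq_unitary_mul [DecidableEq m] (A : Matrix m n ℂ) {V : Matrix m m ℂ}
    (hV : V ∈ Matrix.unitaryGroup m ℂ) : frobSq (V * A) = frobSq A := by
  rw [← frobSq_conjTranspose, Matrix.conjTranspose_mul,
    frobSq_mul_unitary _ (conjTranspose_mem_unitaryGroup hV), frobSq_conjTranspose]

end Frobenius

/-! ### Singular value decomposition -/

section SVD

variable {K L : ℕ}

lemma singVal_nonneg (G : Matrix (Fin K) (Fin L) ℂ) (i : ℕ) : 0 ≤ singVal G i :=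
  LinearMap.singularValues_nonneg _ _

lemma singVal_antitone (G : Matrix (Fin K) (Fin L) ℂ) : Antitone (singVal G) :=
  LinearMap.singularValues_antitone _

lemma singVal_eq_zero_of_le (G : Matrix (Fin K) (Fin L) ℂ) {i : ℕ} (hi : K ≤ i) :
    singVal G i = 0 := by
  unfold singVal
  rw [LinearMap.singularValues_eq_zero_iff_le_finrank_range]
  refine le_trans ?_ hi
  simpa using Submodule.finrank_le (LinearMap.range (Matrix.toEuclideanLin G))

lemma singVal_zero_pos {G : Matrix (Fin K) (Fin L) ℂ} (hG : G ≠ 0) : 0 < singVal G 0 := by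
  refine lt_of_le_of_ne (singVal_nonneg G 0) fun h => hG ?_
  have h0 : (Matrix.toEuclideanLin G).singularValues = 0 := by
    ext i
    exact le_antisymm ((singVal_antitone G (Nat.zero_le i)).trans h.symm.le) (singVal_nonneg G i)
  rw [LinearMap.singularValues_eq_zero_iff] at h0
  simpa using h0

/-- Existence of a singular value decomposition, as a pair of orthonormal bases. -/
lemma exists_singular_bases (hKL : K ≤ L)
    (T : EuclideanSpace ℂ (Fin L) →ₗ[ℂ] EuclideanSpace ℂ (Fin K)) :
    ∃ (v : OrthonormalBasis (Fin L) ℂ (EuclideanSpace ℂ (Fin L)))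
      (u : OrthonormalBasis (Fin K) ℂ (EuclideanSpace ℂ (Fin K))),
      ∀ (i : Fin K) (j : Fin L), inner ℂ (u i) (T (v j)) =
        if (i : ℕ) = (j : ℕ) then (T.singularValues i : ℂ) else 0 := by
  have hL : Module.finrank ℂ (EuclideanSpace ℂ (Fin L)) = L := by simp
  set v := T.isSymmetric_adjoint_comp_self.eigenvectorBasis hL with hv
  have hTT : ∀ i j : Fin L, inner ℂ (T (v i)) (T (v j)) =
      if i = j then ((T.singularValues j ^ 2 : ℝ) : ℂ) else 0 := by
    intro i j
    have h1 : inner ℂ (T (v i)) (T (v j)) = inner ℂ (v i) ((LinearMap.adjoint T ∘ₗ T) (v j)) := by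
      rw [LinearMap.comp_apply, LinearMap.adjoint_inner_right]
    rw [h1, hv, LinearMap.IsSymmetric.apply_eigenvectorBasis, inner_smul_right,
      OrthonormalBasis.inner_eq_ite, T.sq_singularValues_fin hL]
    split_ifs <;> simp
  have hrank : ∀ j : ℕ, K ≤ j → T.singularValues j = 0 := fun j hj => by
    rw [LinearMap.singularValues_eq_zero_iff_le_finrank_range]
    exact le_trans (by simpa using Submodule.finrank_le (LinearMap.range T)) hj
  -- Normalized images of the right singular vectors. Where the singular value is `0` its inverse is
  -- `0` too, so only the indices in `s` give unit vectors; the basis extension supplies the rest.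
  let w : Fin K → EuclideanSpace ℂ (Fin K) := fun i =>
    ((T.singularValues i : ℂ)⁻¹) • T (v (Fin.castLE hKL i))
  let s : Set (Fin K) := {i | T.singularValues i ≠ 0}
  have hw : Orthonormal ℂ (s.domRestrict w) := by
    rw [orthonormal_iff_ite]
    rintro ⟨i, hi⟩ ⟨j, hj⟩
    simp only [Set.domRestrict_apply, w, inner_smul_left, inner_smul_right, hTT, Fin.castLE_inj,
      Subtype.mk.injEq, Fin.val_castLE]
    split_ifs with h
    · subst h
      have : (T.singularValues i : ℂ) ≠ 0 := by exact_mod_cast hi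
      simp only [map_inv₀, Complex.conj_ofReal]
      push_cast
      field_simp
    · simp
  obtain ⟨u, hu⟩ := hw.exists_orthonormalBasis_extension_of_card_eq (by simp)
  have hTv : ∀ (i : Fin K), T (v (Fin.castLE hKL i)) = (T.singularValues i : ℂ) • u i := by
    intro i
    by_cases hi : T.singularValues i = 0
    · have := hTT (Fin.castLE hKL i) (Fin.castLE hKL i)
      simp [hi] at this
      simp [hi, this]
    · rw [hu i hi]
      have : (T.singularValues i : ℂ) ≠ 0 := by exact_mod_cast hi
      simp only [w, smul_smul, mul_inv_cancel₀ this, one_smul]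
  refine ⟨v, u, fun i j => ?_⟩
  by_cases hj : (j : ℕ) < K
  · have : j = Fin.castLE hKL ⟨j, hj⟩ := by ext; simp
    rw [this, hTv, inner_smul_right, OrthonormalBasis.inner_eq_ite]
    simp only [Fin.ext_iff, Fin.val_castLE]
    split_ifs with h
    · simp [h]
    · simp
  · have h1 := hTT j j
    rw [if_pos rfl, hrank j (by omega)] at h1
    have h2 : T (v j) = 0 := by simpa using h1
    rw [h2, inner_zero_right, if_neg (by have := i.isLt; omega)]

/-- The unitary matrix whose columns are an orthonormal basis. -/
lemma orthonormalBasis_matrix_mem_unitaryGroup {n : Type*} [Fintype n] [DecidableEq n]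
    (v : OrthonormalBasis n ℂ (EuclideanSpace ℂ n)) :
    (Matrix.of fun i j => v j i) ∈ Matrix.unitaryGroup n ℂ := by
  rw [Matrix.mem_unitaryGroup_iff']
  ext i j
  have := v.inner_eq_ite i j
  rw [PiLp.inner_apply] at this
  simp only [Matrix.mul_apply, Matrix.star_apply, Matrix.of_apply, Matrix.one_apply]
  rw [← this]
  refine Finset.sum_congr rfl fun k _ => ?_
  simp [mul_comm]

lemma exists_isRightSingular (hKL : K ≤ L) (G : Matrix (Fin K) (Fin L) ℂ) :
    ∃ V, IsRightSingular G V := by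
  obtain ⟨v, u, h⟩ := exists_singular_bases hKL (Matrix.toEuclideanLin G)
  set V : Matrix (Fin L) (Fin L) ℂ := Matrix.of fun i j => v j i
  set W : Matrix (Fin K) (Fin K) ℂ := Matrix.of fun i j => u j i
  have hV : V ∈ Matrix.unitaryGroup _ ℂ := orthonormalBasis_matrix_mem_unitaryGroup v
  have hW : W ∈ Matrix.unitaryGroup _ ℂ := orthonormalBasis_matrix_mem_unitaryGroup u
  refine ⟨V, hV, W, hW, ?_⟩
  have key : Wᴴ * (G * V) = singMatrix G := by
    ext i j
    have := h i j
    rw [PiLp.inner_apply] at this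
    rw [singMatrix, Matrix.of_apply]
    unfold singVal
    rw [← this, Matrix.mul_apply]
    refine Finset.sum_congr rfl fun k _ => ?_
    simp only [Matrix.conjTranspose_apply, W, V, Matrix.of_apply, Matrix.mul_apply,
      Matrix.toLpLin_apply, Matrix.mulVec, dotProduct, RCLike.inner_apply]
    rw [mul_comm]; rfl
  have h1 : W * Wᴴ = 1 := Matrix.mem_unitaryGroup_iff.mp hW
  have h2 : V * Vᴴ = 1 := Matrix.mem_unitaryGroup_iff.mp hV
  rw [← key, ← Matrix.mul_assoc W, h1, Matrix.one_mul, Matrix.mul_assoc, h2, Matrix.mul_one]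

end SVD

/-! ### A unitary matrix with entries of equal modulus -/

/-- The normalized discrete Fourier transform matrix. -/
lemma exists_unitary_norm_eq (p : ℕ) (hp : 0 < p) :
    ∃ U ∈ Matrix.unitaryGroup (Fin p) ℂ, ∀ i j, ‖U i j‖ ^ 2 = 1 / (p : ℝ) := by
  have hp0 : (p : ℂ) ≠ 0 := by exact_mod_cast hp.ne'
  have hω := Complex.isPrimitiveRoot_exp p hp.ne'
  set ω := Complex.exp (2 * Real.pi * Complex.I / p) with hωdef
  have hω1 : ‖ω‖ = 1 := hω.norm'_eq_one hp.ne'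
  have hsq : ((Real.sqrt p : ℝ) : ℂ) * (Real.sqrt p : ℝ) = p := by
    rw [← Complex.ofReal_mul, Real.mul_self_sqrt (by positivity)]; simp
  refine ⟨Matrix.of fun i j => (Real.sqrt p : ℂ)⁻¹ * ω ^ ((i : ℕ) * (j : ℕ)), ?_, fun i j => ?_⟩
  · rw [Matrix.mem_unitaryGroup_iff]
    ext i j
    have hc : star ω = ω⁻¹ := by
      rw [Complex.star_def, Complex.inv_def, Complex.normSq_eq_norm_sq, hω1]; simp
    have hω0 : ω ≠ 0 := by intro h; simp [h] at hω1
    simp only [Matrix.mul_apply, Matrix.star_apply, Matrix.of_apply, star_mul', star_inv₀,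
      Complex.star_def, Complex.conj_ofReal, map_pow, Matrix.one_apply]
    rw [← Complex.star_def, hc]
    have : ∀ x : Fin p, (Real.sqrt p : ℂ)⁻¹ * ω ^ ((i : ℕ) * (x : ℕ)) *
        ((Real.sqrt p : ℂ)⁻¹ * ω⁻¹ ^ ((j : ℕ) * (x : ℕ))) =
        (p : ℂ)⁻¹ * (ω ^ (i : ℕ) * (ω ^ (j : ℕ))⁻¹) ^ (x : ℕ) := by
      intro x
      rw [← hsq, mul_inv, mul_pow, pow_mul, pow_mul, inv_pow]
      ring
    simp_rw [this]
    rw [← Finset.mul_sum, Fin.sum_univ_eq_sum_range (fun x => (ω ^ (i : ℕ) * (ω ^ (j : ℕ))⁻¹) ^ x)]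
    set z := ω ^ (i : ℕ) * (ω ^ (j : ℕ))⁻¹ with hz
    split_ifs with h
    · subst h
      have : z = 1 := by rw [hz]; exact mul_inv_cancel₀ (pow_ne_zero _ hω0)
      simp [this, hp0]
    · have hz1 : z ≠ 1 := by
        intro h1
        rw [hz, mul_inv_eq_one₀ (pow_ne_zero _ hω0)] at h1
        exact h (Fin.ext (hω.pow_inj i.isLt j.isLt h1))
      have hzp : z ^ p = 1 := by
        rw [hz, mul_pow, inv_pow, pow_right_comm, hω.pow_eq_one, pow_right_comm ω, hω.pow_eq_one]
        simp
      rw [geom_sum_eq hz1, hzp]; simp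
  · simp [hω1, inv_pow]

/-! ### The square root of a positive definite matrix -/

lemma sqrt_conjTranspose {n : Type*} [Fintype n] [DecidableEq n] (C : Matrix n n ℂ) :
    (CFC.sqrt C)ᴴ = CFC.sqrt C :=
  (Matrix.nonneg_iff_posSemidef.mp (CFC.sqrt_nonneg C)).isHermitian

lemma sqrt_mul_sqrt_of_posDef {n : Type*} [Fintype n] [DecidableEq n] {C : Matrix n n ℂ}
    (hC : C.PosDef) : CFC.sqrt C * CFC.sqrt C = C :=
  CFC.sqrt_mul_sqrt_self C hC.posSemidef.nonneg

lemma isUnit_det_sqrt {n : Type*} [Fintype n] [DecidableEq n] {C : Matrix n n ℂ}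
    (hC : C.PosDef) : IsUnit (CFC.sqrt C).det := by
  have h := congrArg Matrix.det (sqrt_mul_sqrt_of_posDef hC)
  rw [Matrix.det_mul] at h
  exact isUnit_of_mul_isUnit_left (h ▸ hC.det_pos.ne'.isUnit)

/-! ### A lower bound for low-rank approximation with a nuclear-norm penalty -/

section LowRank

variable {m n q : Type*} [Fintype m] [Fintype n] [Fintype q]

/-- Singular value decomposition of a matrix with respect to an eigenbasis of `Xᴴ X`; the left
singular vectors for vanishing singular values are `0`. -/
lemma exists_partial_svd [DecidableEq n] (X : Matrix m n ℂ) :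
    ∃ V ∈ Matrix.unitaryGroup n ℂ, ∃ (a : Matrix m n ℂ) (x : n → ℝ),
      (∀ k, 0 ≤ x k) ∧ X * V = a * Matrix.diagonal (fun k => (x k : ℂ)) ∧
      aᴴ * a = Matrix.diagonal (fun k => if x k = 0 then (0 : ℂ) else 1) ∧
      (Finset.univ.filter fun k => x k ≠ 0).card = X.rank := by
  have hH : (Xᴴ * X).IsHermitian := Matrix.isHermitian_conjTranspose_mul_self X
  have hpos : ∀ k, 0 ≤ hH.eigenvalues k :=
    (Matrix.posSemidef_conjTranspose_mul_self X).eigenvalues_nonneg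
  set V : Matrix n n ℂ := (hH.eigenvectorUnitary : Matrix n n ℂ) with hVdef
  have hV : V ∈ Matrix.unitaryGroup n ℂ := hH.eigenvectorUnitary.2
  have hV2 : Vᴴ * V = 1 := Matrix.mem_unitaryGroup_iff'.mp hV
  set x : n → ℝ := fun k => Real.sqrt (hH.eigenvalues k) with hx
  have hxsq : ∀ k, (x k : ℂ) * x k = hH.eigenvalues k := fun k => by
    rw [← Complex.ofReal_mul, Real.mul_self_sqrt (hpos k)]
  have hgram : (X * V)ᴴ * (X * V) = Matrix.diagonal (fun k => (hH.eigenvalues k : ℂ)) := by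
    have h := hH.spectral_theorem
    rw [Unitary.conjStarAlgAut_apply] at h
    have h2 : (Xᴴ * X) * V = V * Matrix.diagonal (fun k => (hH.eigenvalues k : ℂ)) := by
      refine (congrArg (· * V) h).trans ?_
      change V * _ * Vᴴ * V = _
      rw [Matrix.mul_assoc (V * _), hV2, Matrix.mul_one]
      rfl
    rw [Matrix.conjTranspose_mul, Matrix.mul_assoc, ← Matrix.mul_assoc Xᴴ, h2, ← Matrix.mul_assoc,
      hV2, Matrix.one_mul]
  -- The convention `0⁻¹ = 0` makes the columns of `a` vanish exactly at the zero singular values.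
  refine ⟨V, hV, (X * V) * Matrix.diagonal (fun k => (x k : ℂ)⁻¹), x,
    fun k => Real.sqrt_nonneg _, ?_, ?_, ?_⟩
  · ext i k
    rw [Matrix.mul_diagonal, Matrix.mul_diagonal]
    by_cases hk : x k = 0
    · have h0 : hH.eigenvalues k = 0 := by
        have := hxsq k
        rw [hk] at this
        simpa using this.symm
      have h1 : ((X * V)ᴴ * ((X * V)ᴴ)ᴴ) k k = 0 := by
        rw [Matrix.conjTranspose_conjTranspose, hgram, Matrix.diagonal_apply_eq, h0]; simp
      rw [mul_conjTranspose_apply_self] at h1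
      have h2 := (Finset.sum_eq_zero_iff_of_nonneg (fun j _ => by positivity)).mp
        (by exact_mod_cast h1 : ∑ j, ‖(X * V)ᴴ k j‖ ^ 2 = 0) i (Finset.mem_univ _)
      have h3 : (X * V) i k = 0 := by simpa using h2
      rw [h3]; simp
    · have : (x k : ℂ) ≠ 0 := by exact_mod_cast hk
      field_simp
  · rw [Matrix.conjTranspose_mul, Matrix.mul_assoc, ← Matrix.mul_assoc _ (X * V), hgram,
      Matrix.diagonal_conjTranspose, Matrix.diagonal_mul_diagonal, Matrix.diagonal_mul_diagonal]
    congr 1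
    ext k
    simp only [Pi.star_apply, star_inv₀, Complex.star_def, Complex.conj_ofReal]
    rw [← hxsq k]
    split_ifs with hk
    · simp [hk]
    · have : (x k : ℂ) ≠ 0 := by exact_mod_cast hk
      field_simp
  · rw [← Matrix.rank_conjTranspose_mul_self, hH.rank_eq_card_non_zero_eigs, Fintype.card_subtype]
    congr 1
    ext k
    simp [hx, Real.sqrt_eq_zero (hpos k)]

/-- Bessel's inequality for a matrix whose nonzero columns are orthonormal. -/
lemma frobSq_conjTranspose_mul_le [DecidableEq n] {a : Matrix m n ℂ} {c : n → Prop} [DecidablePred c]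
    (ha : aᴴ * a = Matrix.diagonal (fun k => if c k then (0 : ℂ) else 1)) (B : Matrix m q ℂ) :
    frobSq (aᴴ * B) ≤ frobSq B := by
  have hcol : Matrix.diagonal (fun k => if c k then (0 : ℂ) else 1) * aᴴ = aᴴ := by
    ext k i
    rw [Matrix.diagonal_mul]
    split_ifs with hk
    · have h1 : (aᴴ * (aᴴ)ᴴ) k k = 0 := by
        rw [Matrix.conjTranspose_conjTranspose, ha, Matrix.diagonal_apply_eq, if_pos hk]
      rw [mul_conjTranspose_apply_self] at h1
      have h2 := (Finset.sum_eq_zero_iff_of_nonneg (fun j _ => by positivity)).mp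
        (by exact_mod_cast h1 : ∑ j, ‖aᴴ k j‖ ^ 2 = 0) i (Finset.mem_univ _)
      have h3 : aᴴ k i = 0 := by simpa using h2
      rw [h3]; simp
    · simp
  -- Pythagoras: by `hcol`, `a * aᴴ` is an orthogonal projection, and the trace of the left side is
  -- nonnegative.
  have h : (B - a * (aᴴ * B))ᴴ * (B - a * (aᴴ * B)) = Bᴴ * B - (aᴴ * B)ᴴ * (aᴴ * B) := by
    have e : aᴴ * (a * (aᴴ * B)) = aᴴ * B := by
      rw [← Matrix.mul_assoc aᴴ a, ha, ← Matrix.mul_assoc, hcol]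
    simp only [Matrix.conjTranspose_sub, Matrix.conjTranspose_mul, Matrix.conjTranspose_conjTranspose,
      Matrix.sub_mul, Matrix.mul_sub, Matrix.mul_assoc, e]
    abel
  have h' := congrArg Matrix.trace h
  rw [Matrix.trace_sub] at h'
  have e1 : (Bᴴ * B).trace = (frobSq B : ℂ) := by
    rw [Matrix.trace_mul_comm, trace_mul_conjTranspose]
  have e2 : ((aᴴ * B)ᴴ * (aᴴ * B)).trace = (frobSq (aᴴ * B) : ℂ) := by
    rw [Matrix.trace_mul_comm, trace_mul_conjTranspose]
  have e3 : ((B - a * (aᴴ * B))ᴴ * (B - a * (aᴴ * B))).trace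
      = (frobSq (B - a * (aᴴ * B)) : ℂ) := by
    rw [Matrix.trace_mul_comm, trace_mul_conjTranspose]
  rw [e1, e2, e3] at h'
  have h2 : frobSq (B - a * (aᴴ * B)) = frobSq B - frobSq (aᴴ * B) := by exact_mod_cast h'
  linarith [frobSq_nonneg (B - a * (aᴴ * B))]

/-- Cauchy–Schwarz for the Frobenius inner product. It serves to bound the nuclear norm of a product
by the Frobenius norms of its factors. -/
lemma re_trace_mul_le (A : Matrix m n ℂ) (B : Matrix n m ℂ) :
    (A * B).trace.re ≤ Real.sqrt (frobSq A) * Real.sqrt (frobSq B) := by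
  have h1 : (A * B).trace.re ≤ ∑ z : m × n, ‖A z.1 z.2‖ * ‖B z.2 z.1‖ := by
    rw [Fintype.sum_prod_type, Matrix.trace, Complex.re_sum]
    refine Finset.sum_le_sum fun i _ => ?_
    rw [Matrix.diag_apply, Matrix.mul_apply, Complex.re_sum]
    refine Finset.sum_le_sum fun j _ => ?_
    rw [← norm_mul]
    exact Complex.re_le_norm _
  refine h1.trans ((Real.sum_mul_le_sqrt_mul_sqrt _ _ _).trans_eq ?_)
  congr 2
  · rw [Fintype.sum_prod_type]; rfl
  · rw [Fintype.sum_prod_type, Finset.sum_comm]; rfl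

lemma sum_norm_sq_row_of_mem_unitaryGroup {n : Type*} [Fintype n] [DecidableEq n]
    {V : Matrix n n ℂ} (hV : V ∈ Matrix.unitaryGroup n ℂ)
    (i : n) : ∑ k, ‖V i k‖ ^ 2 = 1 := by
  have h : V * Vᴴ = 1 := Matrix.mem_unitaryGroup_iff.mp hV
  have := mul_conjTranspose_apply_self V i
  rw [h, Matrix.one_apply_eq] at this
  exact_mod_cast this.symm

lemma sum_norm_sq_col_of_mem_unitaryGroup {n : Type*} [Fintype n] [DecidableEq n]
    {V : Matrix n n ℂ} (hV : V ∈ Matrix.unitaryGroup n ℂ)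
    (k : n) : ∑ i, ‖V i k‖ ^ 2 = 1 := by
  have := sum_norm_sq_row_of_mem_unitaryGroup (conjTranspose_mem_unitaryGroup hV) k
  simpa using this

/-- Jensen's inequality for the convex function `u ↦ ((u - τ)⁺)²`. Weights of total mass below one
suffice because `τ ≥ 0` makes this function vanish at `0`, where the missing mass can be placed. -/
lemma sq_max_sub_le_sum {ι : Type*} (t : Finset ι) (w s : ι → ℝ) {τ : ℝ} (hτ : 0 ≤ τ)
    (hw : ∀ i ∈ t, 0 ≤ w i) (hw1 : ∑ i ∈ t, w i ≤ 1) :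
    max (∑ i ∈ t, w i * s i - τ) 0 ^ 2 ≤ ∑ i ∈ t, w i * max (s i - τ) 0 ^ 2 := by
  have h0 : 0 ≤ ∑ i ∈ t, w i * max (s i - τ) 0 :=
    Finset.sum_nonneg fun i hi => mul_nonneg (hw i hi) (le_max_right _ _)
  have h1 : max (∑ i ∈ t, w i * s i - τ) 0 ≤ ∑ i ∈ t, w i * max (s i - τ) 0 := by
    refine max_le ?_ h0
    have : ∑ i ∈ t, w i * (s i - τ) ≤ ∑ i ∈ t, w i * max (s i - τ) 0 :=
      Finset.sum_le_sum fun i hi => mul_le_mul_of_nonneg_left (le_max_left _ _) (hw i hi)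
    simp only [mul_sub, Finset.sum_sub_distrib, ← Finset.sum_mul] at this
    nlinarith
  have h2 : (∑ i ∈ t, w i * max (s i - τ) 0) ^ 2 ≤
      (∑ i ∈ t, w i) * ∑ i ∈ t, w i * max (s i - τ) 0 ^ 2 := by
    refine Finset.sum_sq_le_sum_mul_sum_of_sq_le_mul t hw
      (fun i hi => mul_nonneg (hw i hi) (sq_nonneg _)) (fun i _ => le_of_eq (by ring))
  have h3 : 0 ≤ ∑ i ∈ t, w i * max (s i - τ) 0 ^ 2 :=
    Finset.sum_nonneg fun i hi => mul_nonneg (hw i hi) (sq_nonneg _)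
  calc _ ≤ (∑ i ∈ t, w i * max (s i - τ) 0) ^ 2 := by gcongr
    _ ≤ _ := h2
    _ ≤ 1 * _ := by gcongr
    _ = _ := one_mul _

/-- The low-rank approximation `B A` of a rectangular diagonal matrix, with the penalty
`2 τ ‖A‖ ‖B‖`, costs at least what soft thresholding of the largest diagonal entries costs. The
threshold `θ` separates the entries that are kept from the others. -/
theorem frobSq_diagonal_sub_mul_ge [DecidableEq m] [DecidableEq n] (ι : m → n) (hι : Function.Injective ι) (s : m → ℝ)
    (hs : ∀ i, 0 ≤ s i) {τ θ : ℝ} (hτ : 0 ≤ τ) (hθ : 0 ≤ θ)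
    (S : Matrix m n ℂ) (hS : ∀ i j, S i j = if ι i = j then (s i : ℂ) else 0)
    (B : Matrix m q ℂ) (A : Matrix q n ℂ) :
    ∑ i, s i ^ 2 - (θ * Fintype.card q + ∑ i, max (max (s i - τ) 0 ^ 2 - θ) 0) ≤
      frobSq (S - B * A) + 2 * τ * (Real.sqrt (frobSq A) * Real.sqrt (frobSq B)) := by
  obtain ⟨V, hV, a, x, hx, hXV, haa, hrank⟩ := exists_partial_svd (B * A)
  -- The only place where the inner dimension, i.e. the number of quantizers, limits the rank.
  have hcard : ((Finset.univ.filter fun k => x k ≠ 0).card : ℝ) ≤ Fintype.card q := by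
    rw [hrank]
    exact_mod_cast (Matrix.rank_mul_le_right B A).trans (Matrix.rank_le_card_height A)
  have hcol : ∀ k, ∑ i, ‖a i k‖ ^ 2 = if x k = 0 then 0 else 1 := fun k => by
    have h1 := mul_conjTranspose_apply_self aᴴ k
    rw [Matrix.conjTranspose_conjTranspose, haa, Matrix.diagonal_apply_eq] at h1
    simp only [Matrix.conjTranspose_apply, norm_star] at h1
    have : (((if x k = 0 then 0 else 1 : ℝ)) : ℂ) = ((∑ i, ‖a i k‖ ^ 2 : ℝ) : ℂ) := by
      rw [← h1]; split_ifs <;> simp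
    exact (Complex.ofReal_injective this).symm
  have hrow : ∀ i, ∑ k, ‖a i k‖ ^ 2 ≤ 1 := fun i => by
    -- Bessel's inequality for the `i`-th standard basis vector, written as a one-column matrix.
    have h := frobSq_conjTranspose_mul_le (q := Unit) (c := fun k => x k = 0) haa
      (Matrix.of fun j _ => if j = i then (1 : ℂ) else 0)
    simpa [frobSq, Matrix.mul_apply, apply_ite] using h
  -- The nuclear norm of `B A` is the trace of `(aᴴ B)(A V)`; Cauchy–Schwarz applies, and neither
  -- `aᴴ` nor `V` increases a Frobenius norm.
  have hnuc : ∑ k, x k ≤ Real.sqrt (frobSq A) * Real.sqrt (frobSq B) := by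
    have h1 : aᴴ * B * (A * V) = Matrix.diagonal (fun k => (x k : ℂ)) := by
      rw [Matrix.mul_assoc, ← Matrix.mul_assoc B, hXV, ← Matrix.mul_assoc, haa,
        Matrix.diagonal_mul_diagonal]
      congr 1
      ext k
      split_ifs with hk <;> simp [hk]
    have h2 : (aᴴ * B * (A * V)).trace.re = ∑ k, x k := by
      rw [h1, Matrix.trace_diagonal, Complex.re_sum]; simp
    rw [← h2, mul_comm]
    refine (re_trace_mul_le _ _).trans ?_
    rw [frobSq_mul_unitary A hV]
    gcongr
    exact frobSq_conjTranspose_mul_le (c := fun k => x k = 0) haa B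
  -- Doubly substochastic weights from `|a||V| ≤ (|a|² + |V|²)/2`; they replace von Neumann's trace
  -- inequality.
  set w : n → m → ℝ := fun k i => (‖a i k‖ ^ 2 + ‖V (ι i) k‖ ^ 2) / 2 with hw
  have hw0 : ∀ k i, 0 ≤ w k i := fun k i => by simp only [hw]; positivity
  have hwrow : ∀ k, ∑ i, w k i ≤ 1 := fun k => by
    have h1 : ∑ i, ‖a i k‖ ^ 2 ≤ 1 := by rw [hcol k]; split_ifs <;> norm_num
    have h2 : ∑ i, ‖V (ι i) k‖ ^ 2 ≤ 1 := by
      rw [← sum_norm_sq_col_of_mem_unitaryGroup hV k,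
        ← Finset.sum_image (f := fun j => ‖V j k‖ ^ 2) (g := ι) (s := Finset.univ) hι.injOn]
      exact Finset.sum_le_sum_of_subset_of_nonneg (Finset.subset_univ _)
        fun _ _ _ => by positivity
    simp only [hw, ← Finset.sum_div, Finset.sum_add_distrib]
    linarith
  have hwcol : ∀ i, ∑ k, w k i ≤ 1 := fun i => by
    simp only [hw, ← Finset.sum_div, Finset.sum_add_distrib]
    linarith [hrow i, sum_norm_sq_row_of_mem_unitaryGroup hV (ι i)]
  have hSV : ∀ i k, (S * V) i k = s i * V (ι i) k := fun i k => by
    simp [Matrix.mul_apply, hS]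
  set ρ : n → ℝ := fun k => ∑ i, (star (a i k) * (S * V) i k).re with hρ
  have hρle : ∀ k, ρ k ≤ ∑ i, w k i * s i := fun k => by
    refine Finset.sum_le_sum fun i _ => ?_
    refine (Complex.re_le_norm _).trans ?_
    rw [hSV, norm_mul, norm_mul, norm_star, Complex.norm_real, Real.norm_eq_abs,
      abs_of_nonneg (hs i)]
    simp only [hw]
    nlinarith [sq_nonneg (‖a i k‖ - ‖V (ι i) k‖), hs i]
  have hexpand : frobSq (S - B * A) = ∑ i, s i ^ 2 + ∑ k, (x k ^ 2 - 2 * x k * ρ k) := by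
    have hfs : ∑ i, s i ^ 2 = ∑ k, ∑ i, ‖(S * V) i k‖ ^ 2 := by
      rw [Finset.sum_comm]
      refine Finset.sum_congr rfl fun i _ => ?_
      simp only [hSV, norm_mul, mul_pow, ← Finset.mul_sum,
        sum_norm_sq_row_of_mem_unitaryGroup hV, Complex.norm_real, Real.norm_eq_abs, sq_abs,
        mul_one]
    rw [← frobSq_mul_unitary _ hV, Matrix.sub_mul, hXV, hfs, ← Finset.sum_add_distrib, frobSq,
      Finset.sum_comm]
    refine Finset.sum_congr rfl fun k _ => ?_
    have hxk : x k ^ 2 = ∑ i, x k ^ 2 * ‖a i k‖ ^ 2 := by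
      rw [← Finset.mul_sum, hcol k]; split_ifs with h <;> simp [h]
    rw [hxk, hρ, Finset.mul_sum, ← Finset.sum_sub_distrib, ← Finset.sum_add_distrib]
    refine Finset.sum_congr rfl fun i _ => ?_
    rw [Matrix.sub_apply, Matrix.mul_diagonal]
    simp only [Complex.sq_norm, Complex.normSq_apply, Complex.sub_re, Complex.sub_im,
      Complex.mul_re, Complex.mul_im, Complex.ofReal_re, Complex.ofReal_im, Complex.star_def,
      Complex.conj_re, Complex.conj_im]
    ring
  -- For fixed `k`, the minimum over `x ≥ 0` of `x² - 2xρ + 2τx` is `-((ρ - τ)⁺)²`, attained at the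
  -- soft threshold `(ρ - τ)⁺`.
  have hk : ∀ k, -(if x k ≠ 0 then ∑ i, w k i * max (s i - τ) 0 ^ 2 else 0) ≤
      x k ^ 2 - 2 * x k * ρ k + 2 * τ * x k := fun k => by
    split_ifs with h
    · have h1 : max (ρ k - τ) 0 ^ 2 ≤ ∑ i, w k i * max (s i - τ) 0 ^ 2 := by
        refine le_trans ?_ (sq_max_sub_le_sum Finset.univ (w k) s hτ (fun i _ => hw0 k i) (hwrow k))
        have := hρle k
        gcongr
      have h2 : ρ k - τ ≤ max (ρ k - τ) 0 := le_max_left _ _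
      nlinarith [sq_nonneg (x k - max (ρ k - τ) 0), hx k]
    · simp only [ne_eq, not_not] at h
      simp [h]
  -- Here `θ` is the multiplier of the rank constraint: a gain `f` is at most `θ + (f - θ)⁺`. The
  -- row sums of `w` bound the first part by `θ` for each active `k`, the column sums bound the
  -- second.
  have htot : ∑ k, (if x k ≠ 0 then ∑ i, w k i * max (s i - τ) 0 ^ 2 else 0) ≤
      θ * Fintype.card q + ∑ i, max (max (s i - τ) 0 ^ 2 - θ) 0 := by
    have h1 : ∀ k, (if x k ≠ 0 then ∑ i, w k i * max (s i - τ) 0 ^ 2 else 0) ≤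
        (if x k ≠ 0 then θ else 0) + ∑ i, w k i * max (max (s i - τ) 0 ^ 2 - θ) 0 := fun k => by
      have h0 : 0 ≤ ∑ i, w k i * max (max (s i - τ) 0 ^ 2 - θ) 0 :=
        Finset.sum_nonneg fun i _ => mul_nonneg (hw0 k i) (le_max_right _ _)
      split_ifs with h
      · have : ∑ i, w k i * max (s i - τ) 0 ^ 2 ≤
            ∑ i, (w k i * θ + w k i * max (max (s i - τ) 0 ^ 2 - θ) 0) :=
          Finset.sum_le_sum fun i _ => by
            rw [← mul_add]
            refine mul_le_mul_of_nonneg_left ?_ (hw0 k i)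
            linarith [le_max_left (max (s i - τ) 0 ^ 2 - θ) 0]
        rw [Finset.sum_add_distrib, ← Finset.sum_mul] at this
        nlinarith [hwrow k]
      · linarith
    refine (Finset.sum_le_sum fun k _ => h1 k).trans ?_
    rw [Finset.sum_add_distrib, Finset.sum_comm, ← Finset.sum_filter, Finset.sum_const,
      nsmul_eq_mul, mul_comm]
    refine add_le_add (mul_le_mul_of_nonneg_left hcard hθ) (Finset.sum_le_sum fun i _ => ?_)
    rw [← Finset.sum_mul]
    exact mul_le_of_le_one_left (le_max_right _ _) (hwcol i)
  have hsum := Finset.sum_le_sum fun k (_ : k ∈ Finset.univ) => hk k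
  rw [Finset.sum_neg_distrib, Finset.sum_add_distrib, ← Finset.mul_sum] at hsum
  have h3 : 2 * τ * ∑ k, x k ≤ 2 * τ * (Real.sqrt (frobSq A) * Real.sqrt (frobSq B)) :=
    mul_le_mul_of_nonneg_left hnuc (by positivity)
  linarith

end LowRank

/-! ### The mean squared error of a linear estimate from noisy linear observations -/

section Hilbert

variable {H : Type*} [NormedAddCommGroup H] [InnerProductSpace ℂ H]
  {ι α β : Type*} [Fintype ι] [Fintype α]

/-- The arguments of `inner` are swapped in `hC` since the inner product is conjugate-linear in its
first slot, whereas a covariance conjugates its second factor. -/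
lemma norm_sq_sum_smul (y : α → H) (C : Matrix α α ℂ) (hC : ∀ a a', inner ℂ (y a') (y a) = C a a')
    (D : Matrix β α ℂ) (k : β) :
    ((‖∑ a, D k a • y a‖ ^ 2 : ℝ) : ℂ) = (D * C * Dᴴ) k k := by
  have h := inner_self_eq_norm_sq_to_K (𝕜 := ℂ) (∑ a, D k a • y a)
  push_cast
  refine h.symm.trans ?_
  rw [sum_inner]
  simp only [inner_sum, inner_smul_left, inner_smul_right, hC, Matrix.mul_apply,
    Matrix.conjTranspose_apply, Finset.sum_mul]
  refine Finset.sum_congr rfl fun a _ => Finset.sum_congr rfl fun a' _ => ?_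
  rw [Complex.star_def]; ring

/-- Pythagoras for the error `u + v - w` with `u = g - Γ y`, `v = (Γ - X) y` and `w = B e`. The
normal equations `hyg` make `u` orthogonal to every `y a`, hence to `v`; `w` is orthogonal to both
signals. -/
theorem sum_norm_sq_estimate [Fintype β] [DecidableEq ι] (g : β → H) (y : α → H) (e : ι → H)
    (Cg : Matrix β β ℂ) (C : Matrix α α ℂ) (Γ : Matrix β α ℂ) (σsq : ℝ)
    (hgg : ∀ k, inner ℂ (g k) (g k) = Cg k k)
    (hyy : ∀ a a', inner ℂ (y a') (y a) = C a a')
    (hyg : ∀ k a, inner ℂ (y a) (g k) = (Γ * C) k a)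
    (hye : ∀ l a, inner ℂ (y a) (e l) = 0) (hge : ∀ l k, inner ℂ (g k) (e l) = 0)
    (hee : ∀ l l', inner ℂ (e l') (e l) = if l = l' then (σsq : ℂ) else 0)
    (X : Matrix β α ℂ) (B : Matrix β ι ℂ) :
    ∑ k, ‖g k - ∑ a, X k a • y a - ∑ l, B k l • e l‖ ^ 2 =
      (Cg - Γ * C * Γᴴ).trace.re + ((Γ - X) * C * (Γ - X)ᴴ).trace.re + σsq * frobSq B := by
  have hCh : Cᴴ = C := by
    ext a a'
    rw [Matrix.conjTranspose_apply, ← hyy, ← hyy, Complex.star_def, inner_conj_symm]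
  have key : ∀ k, ‖g k - ∑ a, X k a • y a - ∑ l, B k l • e l‖ ^ 2 =
      ((Cg - Γ * C * Γᴴ) k k).re + (((Γ - X) * C * (Γ - X)ᴴ) k k).re +
        σsq * ∑ l, ‖B k l‖ ^ 2 := by
    intro k
    set u := g k - ∑ a, Γ k a • y a with hu
    set v := ∑ a, (Γ - X) k a • y a with hv
    set w := ∑ l, B k l • e l with hw
    have huvw : g k - ∑ a, X k a • y a - ∑ l, B k l • e l = u + v - w := by
      simp only [hu, hv, hw, Matrix.sub_apply, sub_smul, Finset.sum_sub_distrib]; abel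
    have hyu : ∀ a, inner ℂ (y a) u = 0 := fun a => by
      rw [hu, inner_sub_right, hyg, inner_sum]
      simp only [inner_smul_right, hyy]
      rw [Matrix.mul_apply, sub_self]
    have hvu : inner ℂ v u = 0 := by
      rw [hv, sum_inner]
      exact Finset.sum_eq_zero fun a _ => by rw [inner_smul_left, hyu, mul_zero]
    have hyw : ∀ a, inner ℂ (y a) w = 0 := fun a => by
      rw [hw, inner_sum]
      exact Finset.sum_eq_zero fun l _ => by rw [inner_smul_right, hye, mul_zero]
    have hvw : inner ℂ v w = 0 := by
      rw [hv, sum_inner]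
      exact Finset.sum_eq_zero fun a _ => by rw [inner_smul_left, hyw, mul_zero]
    have hgw : inner ℂ (g k) w = 0 := by
      rw [hw, inner_sum]
      exact Finset.sum_eq_zero fun l _ => by rw [inner_smul_right, hge, mul_zero]
    have huw : inner ℂ u w = 0 := by
      rw [hu, inner_sub_left, hgw, sum_inner, zero_sub, neg_eq_zero]
      exact Finset.sum_eq_zero fun a _ => by rw [inner_smul_left, hyw, mul_zero]
    have hpyth : ‖u + v - w‖ ^ 2 = ‖u‖ ^ 2 + ‖v‖ ^ 2 + ‖w‖ ^ 2 := by
      have huv : inner ℂ u v = 0 := by rw [← inner_conj_symm, hvu, map_zero]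
      have h1 := norm_add_sq (𝕜 := ℂ) u v
      have h2 := norm_sub_sq (𝕜 := ℂ) (u + v) w
      rw [inner_add_left, huw, hvw] at h2
      rw [huv] at h1
      simp only [map_zero, add_zero, mul_zero, sub_zero] at h1 h2
      rw [h2, h1]
    have hnu : ((‖u‖ ^ 2 : ℝ) : ℂ) = (Cg - Γ * C * Γᴴ) k k := by
      have h := inner_self_eq_norm_sq_to_K (𝕜 := ℂ) u
      push_cast
      refine h.symm.trans ?_
      have : inner ℂ u u = inner ℂ (g k) u := by
        conv_lhs => rw [hu]
        rw [inner_sub_left, sum_inner, sub_eq_self]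
        exact Finset.sum_eq_zero fun a _ => by rw [inner_smul_left, hyu, mul_zero]
      rw [this, hu, inner_sub_right, hgg, inner_sum, Matrix.sub_apply]
      congr 1
      have hT : Γ * C * Γᴴ = Γ * (Γ * C)ᴴ := by
        rw [Matrix.conjTranspose_mul, hCh, Matrix.mul_assoc]
      rw [hT, Matrix.mul_apply]
      refine Finset.sum_congr rfl fun a _ => ?_
      rw [inner_smul_right, Matrix.conjTranspose_apply, ← hyg, Complex.star_def, inner_conj_symm]
    have hnv := norm_sq_sum_smul y C hyy (Γ - X) k
    set D : Matrix ι ι ℂ := Matrix.diagonal fun _ => (σsq : ℂ) with hD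
    have hnw := norm_sq_sum_smul e D (fun l l' => by
      rw [hee, hD, Matrix.diagonal_apply]) B k
    have hnw' : ‖w‖ ^ 2 = σsq * ∑ l, ‖B k l‖ ^ 2 := by
      have h3 : (B * D * Bᴴ) k k =
          ((σsq * ∑ l, ‖B k l‖ ^ 2 : ℝ) : ℂ) := by
        have : B * D = (σsq : ℂ) • B := by
          ext i j; rw [hD, Matrix.mul_diagonal, Matrix.smul_apply, smul_eq_mul, mul_comm]
        rw [this, Matrix.smul_mul, Matrix.smul_apply, mul_conjTranspose_apply_self, smul_eq_mul]
        push_cast; rfl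
      rw [h3] at hnw
      exact_mod_cast hnw
    rw [huvw, hpyth, hnw', ← hnu, ← hnv, Complex.ofReal_re, Complex.ofReal_re]
  simp only [key, Finset.sum_add_distrib, ← Finset.mul_sum, Matrix.trace, Matrix.diag_apply,
    Complex.re_sum]
  rfl

end Hilbert

/-! ### Second moments as inner products in `L²`. -/

section MeanSquare

variable {Ω : Type*} {mΩ : MeasurableSpace Ω} {P : Measure Ω}

lemma integral_norm_sq_of_ae_eq {f : Ω → ℂ} (F : Lp ℂ 2 P) (h : F =ᵐ[P] f) :
    ∫ ω, ‖f ω‖ ^ 2 ∂P = ‖F‖ ^ 2 := by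
  have h1 := inner_self_eq_norm_sq_to_K (𝕜 := ℂ) F
  rw [L2.inner_def] at h1
  have h2 : ∫ ω, inner ℂ (F ω) (F ω) ∂P = ((∫ ω, ‖f ω‖ ^ 2 ∂P : ℝ) : ℂ) := by
    rw [← integral_complex_ofReal]
    refine integral_congr_ae ?_
    filter_upwards [h] with ω hω
    rw [hω, inner_self_eq_norm_sq_to_K]
    push_cast; rfl
  rw [h2] at h1
  have h3 : ((∫ ω, ‖f ω‖ ^ 2 ∂P : ℝ) : ℂ) = ((‖F‖ ^ 2 : ℝ) : ℂ) := by
    rw [h1]; push_cast; rfl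
  exact_mod_cast h3

lemma coeFn_sum_smul_toLp {ι : Type*} [Fintype ι] (c : ι → ℂ) {f : ι → Ω → ℂ}
    (hf : ∀ i, MemLp (f i) 2 P) :
    (∑ i, c i • (hf i).toLp (f i) : Lp ℂ 2 P) =ᵐ[P] fun ω => ∑ i, c i * f i ω := by
  have h1 : ∀ᵐ ω ∂P, ∀ i, (c i • (hf i).toLp (f i) : Lp ℂ 2 P) ω = c i * f i ω := by
    rw [ae_all_iff]
    intro i
    filter_upwards [Lp.coeFn_smul (c i) ((hf i).toLp (f i)), (hf i).coeFn_toLp] with ω h1 h2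
    rw [h1, Pi.smul_apply, h2, smul_eq_mul]
  filter_upwards [Lp.coeFn_finsetSum Finset.univ fun i => c i • (hf i).toLp (f i), h1]
    with ω h2 h3
  rw [h2, Finset.sum_apply]
  exact Finset.sum_congr rfl fun i _ => h3 i

lemma inner_toLp_toLp {f f' : Ω → ℂ} (hf : MemLp f 2 P) (hf' : MemLp f' 2 P) :
    inner ℂ (hf'.toLp f') (hf.toLp f) = ∫ ω, f ω * star (f' ω) ∂P := by
  rw [L2.inner_def]
  refine integral_congr_ae ?_
  filter_upwards [hf.coeFn_toLp, hf'.coeFn_toLp] with ω h1 h2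
  rw [h1, h2, RCLike.inner_apply]; rfl

/-- The correlation of a random variable with an observation is that of its conditional
expectation given the observations. -/
lemma integral_mul_star_of_condExp [IsProbabilityMeasure P] {m : MeasurableSpace Ω}
    (hm : m ≤ mΩ) {f h Y : Ω → ℂ} (hf : MemLp f 2 P) (hY : MemLp Y 2 P)
    (hYm : StronglyMeasurable[m] Y) (hcond : P[f | m] =ᵐ[P] h) :
    ∫ ω, f ω * star (Y ω) ∂P = ∫ ω, h ω * star (Y ω) ∂P := by
  have hYs : StronglyMeasurable[m] fun ω => star (Y ω) :=
    continuous_star.comp_stronglyMeasurable hYm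
  have hYL : MemLp (fun ω => star (Y ω)) 2 P := hY.star
  have hint : Integrable (fun ω => f ω * star (Y ω)) P := hf.integrable_mul hYL
  -- Pull-out property of conditional expectation, with complex multiplication as a real bilinear
  -- map.
  have h1 := condExp_bilin_of_aestronglyMeasurable_right (μ := P) (m := m)
    (ContinuousLinearMap.mul ℝ ℂ) hYs.aestronglyMeasurable hint (hf.integrable one_le_two)
  refine (integral_condExp hm).symm.trans (integral_congr_ae ?_)
  filter_upwards [h1, hcond] with ω h2 h3
  refine h2.trans ?_
  rw [h3]; rfl

end MeanSquare

/-! ### Covariances of the stacked source and the mean squared error as a matrix cost. -/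

section Source

variable {Ω : Type*} [MeasurableSpace Ω] {P : Measure Ω}
  {K L : ℕ} {ρ : ℤ → ℝ} {Cg : Matrix (Fin K) (Fin K) ℂ} {Cy : Matrix (Fin L) (Fin L) ℂ}
  {Γ : Matrix (Fin K) (Fin L) ℂ} {g : ℕ → Ω → Fin K → ℂ} {y : ℕ → Ω → Fin L → ℂ}

lemma measurable_stack {n : ℕ} {x : ℕ → Ω → Fin n → ℂ} (hx : ∀ i, Measurable (x i)) (N : ℕ) :
    Measurable (stack x N) :=
  measurable_pi_lambda _ fun p => (measurable_pi_apply p.1).comp (hx p.2)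

lemma perSample_mul {m n l : ℕ} (A : Matrix (Fin m) (Fin n) ℂ) (B : Matrix (Fin n) (Fin l) ℂ)
    (N : ℕ) : perSample A N * perSample B N = perSample (A * B) N := by
  rw [perSample, perSample, perSample, ← Matrix.mul_kronecker_mul, Matrix.one_mul]

lemma perSample_conjTranspose {m n : ℕ} (A : Matrix (Fin m) (Fin n) ℂ) (N : ℕ) :
    (perSample A N)ᴴ = perSample Aᴴ N := by
  rw [perSample, perSample, Matrix.conjTranspose_kronecker, Matrix.conjTranspose_one]

lemma perSample_apply {m n : ℕ} (A : Matrix (Fin m) (Fin n) ℂ) (N : ℕ) (a : Fin m × Fin N)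
    (b : Fin n × Fin N) : perSample A N a b = A a.1 b.1 * if a.2 = b.2 then 1 else 0 := by
  rw [perSample, Matrix.kroneckerMap_apply, Matrix.one_apply]

lemma corr_obs (hsource : IsSource P ρ Cg Cy Γ g y) (hρ : ∀ τ, ρ τ = if τ = 0 then 1 else 0)
    (N : ℕ) (a a' : Fin L × Fin N) :
    ∫ ω, stack y N ω a * star (stack y N ω a') ∂P =
      perSample Cy N a a' := by
  refine (hsource.corr_y a.2 a'.2 a.1 a'.1).trans ?_
  rw [perSample_apply, hρ]
  congr 1
  by_cases h : a.2 = a'.2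
  · simp [h]
  · rw [if_neg h, if_neg (by rw [sub_eq_zero]; exact_mod_cast fun h' => h (Fin.ext h'))]; simp

/-- The model prescribes no cross-covariance. It follows from the MMSE property, since replacing `g`
by its conditional expectation `Γ y` does not change correlations with the observations. -/
lemma corr_des_obs [IsProbabilityMeasure P] (hsource : IsSource P ρ Cg Cy Γ g y) (hρ : ∀ τ, ρ τ = if τ = 0 then 1 else 0)
    (N : ℕ) (k : Fin K × Fin N) (a : Fin L × Fin N) :
    ∫ ω, stack g N ω k * star (stack y N ω a) ∂P =
      (perSample Γ N * perSample Cy N) k a := by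
  have hY : ∀ b : Fin L × Fin N, MemLp (fun ω => stack y N ω b) 2 P :=
    fun b => hsource.memLp_y b.2 b.1
  have hm := (measurable_stack hsource.measurable_y N).comap_le
  have hYm : StronglyMeasurable[MeasurableSpace.comap (stack y N) inferInstance]
      fun ω => stack y N ω a :=
    ((measurable_pi_apply a).comp (comap_measurable (stack y N))).stronglyMeasurable
  refine (integral_mul_star_of_condExp hm (hsource.memLp_g k.2 k.1) (hY a) hYm
    (hsource.mmse N k.2 k.1)).trans ?_
  have h1 : ∀ ω, (Γ *ᵥ y k.2 ω) k.1 * star (stack y N ω a) =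
      ∑ l, Γ k.1 l * (stack y N ω (l, k.2) * star (stack y N ω a)) := fun ω => by
    rw [Matrix.mulVec, dotProduct, Finset.sum_mul]
    exact Finset.sum_congr rfl fun l _ => by simp only [stack]; ring
  simp_rw [h1]
  have hint : ∀ l, Integrable (fun ω => stack y N ω (l, k.2) * star (stack y N ω a)) P :=
    fun l => (hY (l, k.2)).integrable_mul (hY a).star
  rw [integral_finsetSum _ fun l _ => (hint l).const_mul _]
  simp_rw [integral_const_mul, corr_obs hsource hρ]
  rw [perSample_mul, perSample_apply, Matrix.mul_apply, Finset.sum_mul]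
  exact Finset.sum_congr rfl fun l _ => by rw [perSample_apply]; ring

lemma trace_perSample {n : ℕ} (A : Matrix (Fin n) (Fin n) ℂ) (N : ℕ) :
    (perSample A N).trace = N * A.trace := by
  rw [perSample, Matrix.trace_kronecker, Matrix.trace_one, Fintype.card_fin, mul_comm]

/-- Whitening: absorbing `C_y^{1/2}` into `D` turns variances and error powers into squared
Euclidean or Frobenius norms. -/
lemma trace_mul_kronecker_mul_conjTranspose (hCy : Cy.PosDef) {β : Type*} [Fintype β] {N : ℕ}
    (D : Matrix β (Fin L × Fin N) ℂ) :
    D * perSample Cy N * Dᴴ =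
      (D * perSample (CFC.sqrt Cy) N) *
        (D * perSample (CFC.sqrt Cy) N)ᴴ := by
  rw [Matrix.conjTranspose_mul, perSample_conjTranspose, sqrt_conjTranspose, ← Matrix.mul_assoc,
    Matrix.mul_assoc D (perSample _ _) (perSample _ _), perSample_mul, sqrt_mul_sqrt_of_posDef hCy]

/-- The variances of the quantizer inputs are the squared row norms of `A C_y^{1/2}`. -/
lemma integral_norm_sq_analogOutput (hsource : IsSource P ρ Cg Cy Γ g y)
    (hρ : ∀ τ, ρ τ = if τ = 0 then 1 else 0) (hCy : Cy.PosDef) {ι : Type*} {N : ℕ}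
    (A : Matrix ι (Fin L × Fin N) ℂ) (l : ι) :
    ∫ ω, ‖analogOutput y N A ω l‖ ^ 2 ∂P =
      ∑ j, ‖(A * perSample (CFC.sqrt Cy) N) l j‖ ^ 2 := by
  have hY : ∀ b : Fin L × Fin N, MemLp (fun ω => stack y N ω b) 2 P :=
    fun b => hsource.memLp_y b.2 b.1
  have h1 := integral_norm_sq_of_ae_eq _ (coeFn_sum_smul_toLp (A l) hY)
  refine h1.trans ?_
  have h2 := norm_sq_sum_smul (fun b => (hY b).toLp _)
    (perSample Cy N) (fun a a' => by
      rw [inner_toLp_toLp, corr_obs hsource hρ]) (Matrix.of fun (_ : Unit) => A l) ()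
  rw [trace_mul_kronecker_mul_conjTranspose hCy, mul_conjTranspose_apply_self] at h2
  have h3 : ‖∑ a, A l a • (hY a).toLp _‖ ^ 2 = ∑ j, ‖((Matrix.of fun (_ : Unit) => A l) *
      perSample (CFC.sqrt Cy) N) () j‖ ^ 2 := by exact_mod_cast h2
  exact h3

/-- The average MSE, as the MMSE plus the cost of the quantized recovery of the MMSE estimate. -/
theorem avgMSE_eq [IsProbabilityMeasure P] (hsource : IsSource P ρ Cg Cy Γ g y)
    (hρ : ∀ τ, ρ τ = if τ = 0 then 1 else 0) (hCy : Cy.PosDef) {ι : Type*} [Fintype ι]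
    [DecidableEq ι] {κ : ℝ} {M N : ℕ} (hN : 0 < N) (A : Matrix ι (Fin L × Fin N) ℂ)
    (B : Matrix (Fin K × Fin N) ι ℂ) {q : Ω → ι → ℂ} (hq : IsADCOutput P κ M g y N A q) :
    avgMSE P g N B q = mmseValue Cg Cy Γ +
      (frobSq (perSample (gammaTilde Γ Cy) N -
          B * (A * perSample (CFC.sqrt Cy) N)) +
        noisePower M (supportSq P κ y N A) * frobSq B) / (N * K) := by
  have hY : ∀ b : Fin L × Fin N, MemLp (fun ω => stack y N ω b) 2 P :=
    fun b => hsource.memLp_y b.2 b.1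
  have hG : ∀ b : Fin K × Fin N, MemLp (fun ω => stack g N ω b) 2 P :=
    fun b => hsource.memLp_g b.2 b.1
  set E : Ω → ι → ℂ := fun ω l => q ω l - analogOutput y N A ω l with hE
  have hEL : ∀ l, MemLp (fun ω => E ω l) 2 P := hq.memLp
  -- Substituting `q = A y + e` puts the error in the form required by `sum_norm_sq_estimate` with
  -- `X = B A`.
  have hcoe : ∀ k, ((hG k).toLp _ - ∑ a, (B * A) k a • (hY a).toLp _ -
      ∑ l, B k l • (hEL l).toLp _ : Lp ℂ 2 P) =ᵐ[P]
      fun ω => stack g N ω k - (B *ᵥ q ω) k := fun k => by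
    filter_upwards [Lp.coeFn_sub ((hG k).toLp _ - ∑ a, (B * A) k a • (hY a).toLp _)
      (∑ l, B k l • (hEL l).toLp _), Lp.coeFn_sub ((hG k).toLp _)
      (∑ a, (B * A) k a • (hY a).toLp _), (hG k).coeFn_toLp,
      coeFn_sum_smul_toLp ((B * A) k) hY, coeFn_sum_smul_toLp (B k) hEL] with ω h1 h2 h3 h4 h5
    rw [h1, Pi.sub_apply, h2, Pi.sub_apply, h3, h4, h5]
    have h6 : ∑ a, (B * A) k a * stack y N ω a = (B *ᵥ (A *ᵥ stack y N ω)) k := by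
      rw [Matrix.mulVec_mulVec]; rfl
    have h7 : ∑ l, B k l * E ω l = (B *ᵥ q ω) k - (B *ᵥ (A *ᵥ stack y N ω)) k := by
      rw [← Pi.sub_apply, ← Matrix.mulVec_sub]; rfl
    rw [h6, h7]; ring
  have hsq : ∀ k, ∫ ω, ‖stack g N ω k - (B *ᵥ q ω) k‖ ^ 2 ∂P =
      ‖(hG k).toLp _ - ∑ a, (B * A) k a • (hY a).toLp _ - ∑ l, B k l • (hEL l).toLp _‖ ^ 2 :=
    fun k => integral_norm_sq_of_ae_eq _ (hcoe k)
  have hint : ∀ k, Integrable (fun ω => ‖stack g N ω k - (B *ᵥ q ω) k‖ ^ 2) P := fun k => by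
    have : MemLp (fun ω => stack g N ω k - (B *ᵥ q ω) k) 2 P :=
      (Lp.memLp _).ae_eq (hcoe k)
    exact this.integrable_norm_pow two_ne_zero
  have hmain := sum_norm_sq_estimate (fun k => (hG k).toLp _) (fun a => (hY a).toLp _)
    (fun l => (hEL l).toLp _) (perSample Cg N)
    (perSample Cy N) (perSample Γ N)
    (noisePower M (supportSq P κ y N A))
    (fun k => by
      rw [inner_toLp_toLp]
      refine (hsource.corr_g k.2 k.2 k.1 k.1).trans ?_
      rw [perSample_apply, hρ]; simp)
    (fun a a' => by rw [inner_toLp_toLp, corr_obs hsource hρ])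
    (fun k a => by rw [inner_toLp_toLp, corr_des_obs hsource hρ])
    (fun l a => by rw [inner_toLp_toLp]; exact hq.uncorr_obs l a)
    (fun l k => by rw [inner_toLp_toLp]; exact hq.uncorr_des l k)
    (fun l l' => by rw [inner_toLp_toLp]; exact hq.white l l') (B * A) B
  have hN0 : (N : ℝ) ≠ 0 := by exact_mod_cast hN.ne'
  have h1 : (perSample Cg N - perSample Γ N *
      perSample Cy N * (perSample Γ N)ᴴ).trace.re =
      N * (Cg - Γ * Cy * Γᴴ).trace.re := by
    rw [perSample_conjTranspose, perSample_mul, perSample_mul, Matrix.trace_sub,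
      trace_perSample, trace_perSample, ← mul_sub, ← Matrix.trace_sub,
      ← Complex.ofReal_natCast, Complex.re_ofReal_mul]
  have h2 : ((perSample Γ N - B * A) *
      perSample Cy N *
      (perSample Γ N - B * A)ᴴ).trace.re =
      frobSq (perSample (gammaTilde Γ Cy) N -
          B * (A * perSample (CFC.sqrt Cy) N)) := by
    rw [trace_mul_kronecker_mul_conjTranspose hCy, trace_mul_conjTranspose, Complex.ofReal_re,
      Matrix.sub_mul, perSample_mul, Matrix.mul_assoc]
    rfl
  unfold avgMSE mmseValue
  rw [integral_finsetSum _ fun k _ => hint k]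
  simp_rw [hsq]
  rw [hmain, h1, h2]
  field_simp
  ring

end Source

/-! ### Water filling -/

lemma phi_nonneg (α : ℝ) : 0 ≤ phi α := le_max_right _ _

lemma phi_mono : Monotone phi := fun _ _ h => max_le_max (sub_le_sub_right h 1) le_rfl

lemma continuous_phi : Continuous phi := by unfold phi; fun_prop

section WaterFilling

variable {K L p : ℕ} {G : Matrix (Fin K) (Fin L) ℂ} {κ : ℝ} {M : ℕ} {ζ : ℝ}

/-- The water-filling condition with the noise coefficient `c = 4 κ / (3 M²)`. -/
lemma WaterFilling.eq_one (h : WaterFilling G p κ M ζ) :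
    4 * κ / (3 * (M : ℝ) ^ 2) / p * ∑ i ∈ Finset.range p, phi (ζ * singVal G i) = 1 := by
  rw [← h, div_div]

lemma WaterFilling.pos (h : WaterFilling G p κ M ζ) : 0 < ζ := by
  by_contra! hζ
  have h0 : ∑ i ∈ Finset.range p, phi (ζ * singVal G i) = 0 :=
    Finset.sum_eq_zero fun i _ => max_eq_right (by
      have := mul_nonpos_of_nonpos_of_nonneg hζ (singVal_nonneg G i)
      linarith)
  unfold WaterFilling at h
  rw [h0, mul_zero] at h
  exact zero_ne_one h

/-- The left side is continuous, vanishes at `0` and is unbounded because `σ_0 > 0`. It is strictly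
increasing wherever it is positive, so the value `1` is taken exactly once. -/
theorem existsUnique_waterFilling (hG : G ≠ 0) (hp : 0 < p) (hκ : 0 < κ) (hM : 0 < M) :
    ∃! ζ : ℝ, WaterFilling G p κ M ζ := by
  set C : ℝ := 4 * κ / (3 * (M : ℝ) ^ 2 * p) with hC
  have hM' : (0 : ℝ) < M := by exact_mod_cast hM
  have hp' : (0 : ℝ) < p := by exact_mod_cast hp
  have hC0 : 0 < C := by positivity
  have hσ := singVal_zero_pos hG
  set F : ℝ → ℝ := fun ζ => C * ∑ i ∈ Finset.range p, phi (ζ * singVal G i) with hF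
  have hFc : Continuous F := by
    refine continuous_const.mul (continuous_finsetSum _ fun i _ => ?_)
    exact continuous_phi.comp (continuous_id.mul continuous_const)
  have hterm : ∀ ζ, C * phi (ζ * singVal G 0) ≤ F ζ := fun ζ => by
    refine mul_le_mul_of_nonneg_left ?_ hC0.le
    exact Finset.single_le_sum (f := fun i => phi (ζ * singVal G i)) (fun i _ => phi_nonneg _)
      (Finset.mem_range.mpr hp)
  have hF0 : F 0 = 0 := by simp [hF, phi]
  -- Chosen so that the term of the largest singular value alone contributes `C (b σ_0 - 1) = 1`.
  set b : ℝ := (1 / C + 1) / singVal G 0 with hb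
  have hb0 : 0 ≤ b := by positivity
  have hFb : 1 ≤ F b := by
    refine le_trans ?_ (hterm b)
    have h1 : b * singVal G 0 - 1 ≤ phi (b * singVal G 0) := le_max_left _ _
    have h2 : b * singVal G 0 - 1 = 1 / C := by rw [hb]; field_simp; ring
    calc (1 : ℝ) = C * (1 / C) := by field_simp
      _ ≤ _ := mul_le_mul_of_nonneg_left (h2 ▸ h1) hC0.le
  obtain ⟨ζ, -, hζ⟩ := intermediate_value_Icc hb0 hFc.continuousOn
    (show (1 : ℝ) ∈ Set.Icc (F 0) (F b) from ⟨by rw [hF0]; exact zero_le_one, hFb⟩)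
  refine ⟨ζ, hζ, ?_⟩
  have hlt : ∀ z w, F z = 1 → F w = 1 → ¬ z < w := fun z w hz hw hzw => by
    have hz0 : 0 < z := WaterFilling.pos (G := G) (p := p) (κ := κ) (M := M) hz
    -- If the largest singular value were not active, no other would be, and the sum would be `0`.
    have h1 : 0 < phi (z * singVal G 0) := by
      by_contra! h
      have h0 : ∑ i ∈ Finset.range p, phi (z * singVal G i) = 0 :=
        Finset.sum_eq_zero fun i _ => le_antisymm ((phi_mono (mul_le_mul_of_nonneg_left
          (singVal_antitone G (Nat.zero_le i)) hz0.le)).trans h) (phi_nonneg _)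
      simp only [hF, h0, mul_zero] at hz
      exact zero_ne_one hz
    have h2 : phi (z * singVal G 0) < phi (w * singVal G 0) := by
      unfold phi at h1 ⊢
      rw [lt_max_iff] at h1
      have h3 := h1.resolve_right (lt_irrefl _)
      rw [max_eq_left h3.le]
      refine lt_max_of_lt_left ?_
      have := mul_lt_mul_of_pos_right hzw hσ
      linarith
    have h3 : F z < F w := by
      refine mul_lt_mul_of_pos_left (Finset.sum_lt_sum (fun i _ => ?_)
        ⟨0, Finset.mem_range.mpr hp, h2⟩) hC0
      exact phi_mono (mul_le_mul_of_nonneg_right hzw.le (singVal_nonneg G i))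
    rw [hz, hw] at h3
    exact lt_irrefl _ h3
  intro w hw
  exact le_antisymm (not_lt.mp (hlt ζ w hζ hw)) (not_lt.mp (hlt w ζ hw hζ))

end WaterFilling

/-- The minimal cost of the recovery of the MMSE estimate, as a function of the singular values. -/
noncomputable def waterCost (σ : ℕ → ℝ) (K p : ℕ) (ζ : ℝ) : ℝ :=
  ∑ i ∈ Finset.range (min K p), σ i ^ 2 / (phi (ζ * σ i) + 1) + ∑ i ∈ Finset.Ico p K, σ i ^ 2

lemma sum_range_eq_of_eq_zero {h : ℕ → ℝ} {K p : ℕ} (hK : ∀ i, K ≤ i → h i = 0)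
    (hp : ∀ i, p ≤ i → h i = 0) : ∑ i ∈ Finset.range K, h i = ∑ i ∈ Finset.range p, h i := by
  rcases le_total K p with hle | hle
  · exact Finset.sum_subset (Finset.range_mono hle) fun i _ hi => hK i (by simpa using hi)
  · exact (Finset.sum_subset (Finset.range_mono hle) fun i _ hi => hp i (by simpa using hi)).symm

lemma waterCost_eq {σ : ℕ → ℝ} {K p : ℕ} (hσK : ∀ i, K ≤ i → σ i = 0) (ζ : ℝ) :
    waterCost σ K p ζ =
      ∑ i ∈ Finset.range p, σ i ^ 2 / (phi (ζ * σ i) + 1) + ∑ i ∈ Finset.Ico p K, σ i ^ 2 := by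
  unfold waterCost
  congr 1
  refine Finset.sum_subset (Finset.range_mono (min_le_right _ _)) fun i h1 h2 => ?_
  simp only [Finset.mem_range, lt_min_iff, not_and, not_lt] at h1 h2
  rw [hσK i (by by_contra! h; exact absurd h1 (not_lt.mpr (h2 h)))]
  simp

/-- Matches the water-filling cost with the lower bound at `τ = 1/ζ`. Indices start at `0`, so `σ (p
- 1)` is the `p`-th largest value, and with its gain as `θ` the bracket is exactly the sum of the
`p` largest gains (`h1`). The water-filling equation gives `τ² p / c = ∑ τ (σ_i - τ)⁺` (`h3`). -/
lemma waterCost_eq_soft_threshold {σ : ℕ → ℝ} {K p : ℕ} (hσ : Antitone σ)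
    (hσK : ∀ i, K ≤ i → σ i = 0) (hp : 0 < p) {ζ c : ℝ} (hζ : 0 < ζ) (hc : 0 < c)
    (hwf : c / p * ∑ i ∈ Finset.range p, phi (ζ * σ i) = 1) :
    waterCost σ K p ζ = ∑ i ∈ Finset.range K, σ i ^ 2 -
      (max (σ (p - 1) - 1 / ζ) 0 ^ 2 * p +
        ∑ i ∈ Finset.range K, max (max (σ i - 1 / ζ) 0 ^ 2 - max (σ (p - 1) - 1 / ζ) 0 ^ 2) 0) -
      (1 / ζ) ^ 2 * p / c := by
  have hp' : (0 : ℝ) < p := by exact_mod_cast hp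
  set τ := 1 / ζ with hτ
  have hτ0 : 0 < τ := by positivity
  have hζτ : ζ * τ = 1 := by rw [hτ]; field_simp
  set f : ℕ → ℝ := fun i => max (σ i - τ) 0 ^ 2 with hf
  have hfanti : ∀ i j, i ≤ j → f j ≤ f i := fun i j hij => by
    have h1 := hσ hij
    simp only [hf]
    gcongr
  have hphi : ∀ i, phi (ζ * σ i) = ζ * max (σ i - τ) 0 := fun i => by
    unfold phi
    rw [mul_max_of_nonneg _ _ hζ.le, mul_sub, hζτ, mul_zero]
  have h1 : ∑ i ∈ Finset.range K, max (f i - f (p - 1)) 0 =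
      ∑ i ∈ Finset.range p, f i - f (p - 1) * p := by
    rw [sum_range_eq_of_eq_zero (p := p)]
    · have : ∀ i ∈ Finset.range p, max (f i - f (p - 1)) 0 = f i - f (p - 1) := fun i hi =>
        max_eq_left (sub_nonneg.mpr (hfanti _ _ (by have := Finset.mem_range.mp hi; omega)))
      rw [Finset.sum_congr rfl this, Finset.sum_sub_distrib, Finset.sum_const, Finset.card_range,
        nsmul_eq_mul, mul_comm (p : ℝ)]
    · intro i hi
      refine max_eq_right ?_
      have : f i = 0 := by
        simp only [hf, hσK i hi]
        rw [max_eq_right (by linarith)]; simp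
      rw [this, zero_sub, neg_nonpos]
      exact sq_nonneg _
    · exact fun i hi => max_eq_right (sub_nonpos.mpr (hfanti _ _ (by omega)))
  have h2 : ∑ i ∈ Finset.range K, σ i ^ 2 =
      ∑ i ∈ Finset.range p, σ i ^ 2 + ∑ i ∈ Finset.Ico p K, σ i ^ 2 := by
    rcases le_total p K with hle | hle
    · rw [Finset.sum_range_add_sum_Ico _ hle]
    · rw [Finset.Ico_eq_empty (by omega), Finset.sum_empty, add_zero]
      exact Finset.sum_subset (Finset.range_mono hle) fun i _ hi => by
        rw [hσK i (by simpa using hi)]; simp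
  have h3 : τ ^ 2 * p / c = ∑ i ∈ Finset.range p, τ * max (σ i - τ) 0 := by
    simp only [hphi, ← Finset.mul_sum] at hwf ⊢
    have : (p : ℝ) / c = ζ * ∑ i ∈ Finset.range p, max (σ i - τ) 0 := by
      field_simp at hwf ⊢
      linarith
    rw [mul_div_assoc, this, ← mul_assoc, sq, mul_assoc τ τ ζ, mul_comm τ ζ, hζτ, mul_one]
  -- Both sides are `σ²` below the threshold; above it `φ + 1 = ζσ`, and both are `στ`.
  have h4 : ∀ i, σ i ^ 2 / (phi (ζ * σ i) + 1) = σ i ^ 2 - f i - τ * max (σ i - τ) 0 := fun i => by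
    rw [hphi, div_eq_iff (by have := le_max_right (σ i - τ) 0; positivity)]
    simp only [hf]
    rcases le_total (σ i) τ with h | h
    · rw [max_eq_right (by linarith)]; ring
    · rw [max_eq_left (by linarith)]
      have : ζ * (σ i - τ) + 1 = ζ * σ i := by rw [mul_sub, hζτ]; ring
      rw [this]
      linear_combination -(σ i) ^ 2 * hζτ
  change _ = _ - (f (p - 1) * p + ∑ i ∈ Finset.range K, max (f i - f (p - 1)) 0) - _
  rw [waterCost_eq hσK, h1, h2, h3, Finset.sum_congr rfl fun i _ => h4 i, Finset.sum_sub_distrib,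
    Finset.sum_sub_distrib]
  ring

/-! ### The matrices that act on each sample separately -/

section PerSample

lemma perSample_mem_unitaryGroup {n : ℕ} {V : Matrix (Fin n) (Fin n) ℂ}
    (hV : V ∈ Matrix.unitaryGroup (Fin n) ℂ) (N : ℕ) :
    perSample V N ∈ Matrix.unitaryGroup (Fin n × Fin N) ℂ := by
  have h : V * Vᴴ = 1 := Matrix.mem_unitaryGroup_iff.mp hV
  rw [Matrix.mem_unitaryGroup_iff, Matrix.star_eq_conjTranspose, perSample_conjTranspose,
    perSample_mul, h, perSample, Matrix.one_kronecker_one]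

lemma frobSq_perSample {m n : ℕ} (A : Matrix (Fin m) (Fin n) ℂ) (N : ℕ) :
    frobSq (perSample A N) = N * frobSq A := by
  have h := trace_mul_conjTranspose (perSample A N)
  rw [perSample_conjTranspose, perSample_mul, trace_perSample, trace_mul_conjTranspose] at h
  exact_mod_cast h.symm

lemma perSample_sub {m n : ℕ} (A B : Matrix (Fin m) (Fin n) ℂ) (N : ℕ) :
    perSample (A - B) N = perSample A N - perSample B N := by
  ext i j
  simp only [perSample_apply, Matrix.sub_apply, sub_mul]

lemma sum_norm_sq_row_perSample {m n : ℕ} (A : Matrix (Fin m) (Fin n) ℂ) (N : ℕ)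
    (l : Fin m × Fin N) : ∑ j, ‖perSample A N l j‖ ^ 2 = ∑ j, ‖A l.1 j‖ ^ 2 := by
  rw [Fintype.sum_prod_type]
  refine Finset.sum_congr rfl fun j _ => ?_
  rw [Finset.sum_eq_single l.2]
  · simp [perSample_apply]
  · intro b _ hb
    simp [perSample_apply, Ne.symm hb]
  · simp

end PerSample

/-! ### The lower bound for the recovery of the MMSE estimate -/

/-- Here `A` is the analog matrix after whitening. Unitary invariance reduces `G` to its singular
value matrix, and the noise term is traded for the product penalty of `frobSq_diagonal_sub_mul_ge`.
-/
theorem waterCost_le {K L p : ℕ} (hKL : K ≤ L) (hp : 0 < p) (G : Matrix (Fin K) (Fin L) ℂ)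
    {ζ c : ℝ} (hζ : 0 < ζ) (hc : 0 < c)
    (hwf : c / p * ∑ i ∈ Finset.range p, phi (ζ * singVal G i) = 1) {N : ℕ} (hN : 0 < N)
    (A : Matrix (Fin p × Fin N) (Fin L × Fin N) ℂ)
    (B : Matrix (Fin K × Fin N) (Fin p × Fin N) ℂ) :
    N * waterCost (singVal G) K p ζ ≤
      frobSq (perSample G N - B * A) + c * (⨆ l, ∑ j, ‖A l j‖ ^ 2) * frobSq B := by
  obtain ⟨V, hV, W, hW, hG⟩ := exists_isRightSingular hKL G
  set τ := 1 / ζ with hτ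
  have hτ0 : 0 ≤ τ := by positivity
  have hp' : (0 : ℝ) < p := by exact_mod_cast hp
  have hN' : (0 : ℝ) < N := by exact_mod_cast hN
  have hW' := perSample_mem_unitaryGroup hW N
  have hV' := perSample_mem_unitaryGroup hV N
  have hWW : (perSample W N)ᴴ * perSample W N = 1 := Matrix.mem_unitaryGroup_iff'.mp hW'
  have hVV : (perSample V N)ᴴ * perSample V N = 1 := Matrix.mem_unitaryGroup_iff'.mp hV'
  have hcost : frobSq (perSample G N - B * A) =
      frobSq (perSample (singMatrix G) N - (perSample W N)ᴴ * B * (A * perSample V N)) := by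
    rw [← frobSq_mul_unitary _ hV', ← frobSq_unitary_mul _ (conjTranspose_mem_unitaryGroup hW')]
    congr 1
    conv_lhs => rw [hG, ← perSample_mul, ← perSample_mul, ← perSample_conjTranspose]
    rw [Matrix.sub_mul, Matrix.mul_sub, Matrix.mul_assoc _ _ (perSample V N), hVV, Matrix.mul_one,
      ← Matrix.mul_assoc, hWW, Matrix.one_mul]
    simp only [Matrix.mul_assoc]
  -- The threshold `θ` is fixed through its nonnegativity proof: it is the soft-threshold gain of
  -- the `p`-th singular value.
  have hlow := frobSq_diagonal_sub_mul_ge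
    (fun k : Fin K × Fin N => (Fin.castLE hKL k.1, k.2))
    (fun a b h => by
      simp only [Prod.mk.injEq, Fin.castLE_inj] at h
      exact Prod.ext h.1 h.2)
    (fun k => singVal G k.1) (fun k => singVal_nonneg G _) hτ0
    (sq_nonneg (max (singVal G (p - 1) - τ) 0)) (perSample (singMatrix G) N)
    (fun i j => by
      rw [perSample_apply, singMatrix, Matrix.of_apply]
      by_cases h1 : (i.1 : ℕ) = j.1 <;> by_cases h2 : i.2 = j.2 <;>
        simp [h1, h2, Prod.ext_iff, Fin.ext_iff])
    ((perSample W N)ᴴ * B) (A * perSample V N)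
  rw [frobSq_mul_unitary _ hV', frobSq_unitary_mul _ (conjTranspose_mem_unitaryGroup hW'),
    ← hcost] at hlow
  -- In `G ⊗ I` every singular value of `G` occurs `N` times.
  have hsum : ∀ h : ℕ → ℝ, ∑ k : Fin K × Fin N, h k.1 = N * ∑ i ∈ Finset.range K, h i :=
    fun h => by
      rw [Fintype.sum_prod_type, ← Fin.sum_univ_eq_sum_range, Finset.mul_sum]
      simp
  rw [hsum fun i => singVal G i ^ 2,
    hsum fun i => max (max (singVal G i - τ) 0 ^ 2 - max (singVal G (p - 1) - τ) 0 ^ 2) 0,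
    Fintype.card_prod, Fintype.card_fin, Fintype.card_fin] at hlow
  push_cast at hlow
  set a := Real.sqrt (frobSq A) with ha
  set b := Real.sqrt (frobSq B) with hb
  set s := ⨆ l, ∑ j, ‖A l j‖ ^ 2 with hs
  have ha2 : a ^ 2 = frobSq A := Real.sq_sqrt (frobSq_nonneg A)
  have hb2 : b ^ 2 = frobSq B := Real.sq_sqrt (frobSq_nonneg B)
  have hA : a ^ 2 ≤ p * N * s := by
    rw [ha2]
    refine (Finset.sum_le_card_nsmul Finset.univ _ s fun l _ =>
      le_ciSup (f := fun l => ∑ j, ‖A l j‖ ^ 2) (Set.finite_range _).bddAbove l).trans_eq ?_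
    rw [Finset.card_univ, Fintype.card_prod, Fintype.card_fin, Fintype.card_fin, nsmul_eq_mul]
    push_cast; ring
  -- Replace `s` by its lower bound `a²/(pN)` and complete the square in `ab` around `τ pN / c`.
  have hpen : 2 * τ * (a * b) - τ ^ 2 * (p * N) / c ≤ c * s * frobSq B := by
    rw [← hb2]
    have h1 : c / (p * N) * a ^ 2 ≤ c * s := by
      calc c / (p * N) * a ^ 2 ≤ c / (p * N) * (p * N * s) := by gcongr
        _ = c * s := by field_simp
    have h2 : c / (p * N) * a ^ 2 * b ^ 2 ≤ c * s * b ^ 2 := by gcongr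
    have h3 : 0 ≤ c / (p * N) * (a * b - τ * (p * N) / c) ^ 2 := by positivity
    have h4 : c / (p * N) * (a * b - τ * (p * N) / c) ^ 2 =
        c / (p * N) * a ^ 2 * b ^ 2 - 2 * τ * (a * b) + τ ^ 2 * (p * N) / c := by
      field_simp
      ring
    linarith
  rw [waterCost_eq_soft_threshold (singVal_antitone G)
    (fun i hi => singVal_eq_zero_of_le G hi) hp hζ hc hwf]
  have h5 : τ ^ 2 * (p * N) / c = N * (τ ^ 2 * p / c) := by ring
  rw [h5] at hpen
  rw [← hτ]
  linarith

/-! ### The explicit design -/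

section Design

variable {K L p : ℕ} {G : Matrix (Fin K) (Fin L) ℂ} {κ : ℝ} {M : ℕ} {r ζ : ℝ}
  {U : Matrix (Fin p) (Fin p) ℂ} {Λ : Matrix (Fin p) (Fin L) ℂ} {V : Matrix (Fin L) (Fin L) ℂ}

lemma IsDesign.norm_sq (h : IsDesign G κ M r ζ U Λ V)
    (hs : 0 ≤ 4 * κ / (3 * (M : ℝ) ^ 2 * r)) (i : Fin p) (j : Fin L) :
    ‖Λ i j‖ ^ 2 = if (i : ℕ) = j then
      4 * κ / (3 * (M : ℝ) ^ 2 * r) * phi (ζ * singVal G i) else 0 := by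
  split_ifs with hij
  · rw [← norm_pow, h.diag i j hij, Complex.norm_real, Real.norm_eq_abs,
      abs_of_nonneg (mul_nonneg hs (phi_nonneg _))]
  · rw [h.off_diag i j hij]; simp

lemma IsDesign.mul_conjTranspose (h : IsDesign G κ M r ζ U Λ V) (hpL : p ≤ L)
    (hs : 0 ≤ 4 * κ / (3 * (M : ℝ) ^ 2 * r)) :
    Λ * Λᴴ = Matrix.diagonal fun i : Fin p =>
      ((4 * κ / (3 * (M : ℝ) ^ 2 * r) * phi (ζ * singVal G i) : ℝ) : ℂ) := by
  ext i i'
  by_cases hi : i = i'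
  · subst hi
    rw [mul_conjTranspose_apply_self, Matrix.diagonal_apply_eq]
    congr 1
    simp only [h.norm_sq hs]
    rw [Finset.sum_eq_single (Fin.castLE hpL i)]
    · simp
    · intro j _ hj
      rw [if_neg fun h' => hj (Fin.ext h'.symm)]
    · simp
  · rw [Matrix.diagonal_apply_ne _ hi, Matrix.mul_apply]
    refine Finset.sum_eq_zero fun j _ => ?_
    rw [Matrix.conjTranspose_apply]
    by_cases hij : (i : ℕ) = j
    · rw [h.off_diag i' j fun h' => hi (Fin.ext (hij.trans h'.symm))]; simp
    · rw [h.off_diag i j hij]; simp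

/-- The quantizer inputs of the design have equal variances `1 / r`. -/
lemma IsDesign.sum_norm_sq_row (h : IsDesign G κ M r ζ U Λ V) (hpL : p ≤ L) (hp : 0 < p)
    (hr : 0 < r) (hκ : 0 < κ) (hwf : WaterFilling G p κ M ζ) (l : Fin p) :
    ∑ j, ‖(U * Λ * Vᴴ) l j‖ ^ 2 = 1 / r := by
  have hs : 0 ≤ 4 * κ / (3 * (M : ℝ) ^ 2 * r) := by positivity
  have hp' : (p : ℝ) ≠ 0 := by exact_mod_cast hp.ne'
  have hVV : Vᴴ * V = 1 := Matrix.mem_unitaryGroup_iff'.mp h.right_singular.1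
  have hUU : Uᴴ * U = 1 := Matrix.mem_unitaryGroup_iff'.mp h.unitary
  have h1 := mul_conjTranspose_apply_self (U * Λ * Vᴴ) l
  have h2 : (U * Λ * Vᴴ) * (U * Λ * Vᴴ)ᴴ = U * Λ * Λᴴ * Uᴴ := by
    simp only [Matrix.conjTranspose_mul, Matrix.conjTranspose_conjTranspose]
    rw [Matrix.mul_assoc (U * Λ), ← Matrix.mul_assoc Vᴴ, hVV, Matrix.one_mul, ← Matrix.mul_assoc]
  -- Equal diagonal entries are the trace divided by `p`; the water-filling equation sets the trace
  -- to `p / r`.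
  have h3 : (p : ℂ) * (U * Λ * Λᴴ * Uᴴ) l l = (U * Λ * Λᴴ * Uᴴ).trace := by
    refine Eq.symm ((Finset.sum_congr rfl fun i _ => h.equal_diag i l).trans ?_)
    rw [Finset.sum_const, Finset.card_univ, Fintype.card_fin, nsmul_eq_mul]
  have h4 : (U * Λ * Λᴴ * Uᴴ).trace =
      ((4 * κ / (3 * (M : ℝ) ^ 2 * r) * ∑ i ∈ Finset.range p, phi (ζ * singVal G i) : ℝ) : ℂ) := by
    rw [Matrix.trace_mul_comm, ← Matrix.mul_assoc, ← Matrix.mul_assoc, hUU, Matrix.one_mul,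
      h.mul_conjTranspose hpL hs, Matrix.trace_diagonal, ← Fin.sum_univ_eq_sum_range, Finset.mul_sum]
    push_cast; rfl
  have h5 : 4 * κ / (3 * (M : ℝ) ^ 2 * r) * ∑ i ∈ Finset.range p, phi (ζ * singVal G i) = p / r := by
    have := hwf.eq_one
    have e : 4 * κ / (3 * (M : ℝ) ^ 2 * r) * ∑ i ∈ Finset.range p, phi (ζ * singVal G i) =
      p / r * (4 * κ / (3 * (M : ℝ) ^ 2) / p * ∑ i ∈ Finset.range p, phi (ζ * singVal G i)) := by
      field_simp
    rw [e, this, mul_one]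
  rw [h4, h5, ← h2, h1] at h3
  have h6 : (p : ℝ) * ∑ j, ‖(U * Λ * Vᴴ) l j‖ ^ 2 = p / r := by exact_mod_cast h3
  field_simp at h6 ⊢
  linarith

/-- The cost of the design. -/
theorem IsDesign.cost_eq (h : IsDesign G κ M r ζ U Λ V) (hKL : K ≤ L) (hpL : p ≤ L) (hr : 0 < r)
    (hκ : 0 < κ) (hM : 0 < M) :
    frobSq (G - digitalMatrix G M (κ / r) U Λ V * (U * Λ * Vᴴ)) +
      noisePower M (κ / r) * frobSq (digitalMatrix G M (κ / r) U Λ V) =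
      waterCost (singVal G) K p ζ := by
  obtain ⟨hV, W, hW, hG⟩ := h.right_singular
  have hM' : (0 : ℝ) < M := by exact_mod_cast hM
  set s := 4 * κ / (3 * (M : ℝ) ^ 2 * r) with hsdef
  have hs : 0 < s := by positivity
  have hnp : noisePower M (κ / r) = s := by rw [noisePower, hsdef]; field_simp
  have hVV : Vᴴ * V = 1 := Matrix.mem_unitaryGroup_iff'.mp hV
  have hUU : Uᴴ * U = 1 := Matrix.mem_unitaryGroup_iff'.mp h.unitary
  set φ : ℕ → ℝ := fun i => phi (ζ * singVal G i) with hφ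
  have hφ0 : ∀ i, 0 ≤ φ i := fun i => phi_nonneg _
  set E : Matrix (Fin p) (Fin p) ℂ := Matrix.diagonal fun i => ((1 / (s * (φ i + 1)) : ℝ) : ℂ)
    with hE
  -- The scale `s` of `Λ Λᴴ` is also the noise power, so the diagonal entries to invert are `s (φ_i
  -- + 1)`.
  have hinv : (Λ * Λᴴ + (noisePower M (κ / r) : ℂ) • (1 : Matrix (Fin p) (Fin p) ℂ))⁻¹ = E := by
    refine Matrix.inv_eq_right_inv ?_
    rw [h.mul_conjTranspose hpL hs.le, hnp, hE, Matrix.smul_one_eq_diagonal, Matrix.diagonal_add,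
      Matrix.diagonal_mul_diagonal, ← Matrix.diagonal_one]
    congr 1
    ext i
    have := hφ0 i
    rw [← Complex.ofReal_add, ← Complex.ofReal_mul, Complex.ofReal_eq_one]
    change (s * φ i + s) * (1 / (s * (φ i + 1))) = 1
    field_simp
  have hB : digitalMatrix G M (κ / r) U Λ V = W * (singMatrix G * Λᴴ * E) * Uᴴ := by
    rw [digitalMatrix, hinv]
    conv_lhs => rw [hG]
    rw [Matrix.mul_assoc (W * singMatrix G), hVV, Matrix.mul_one]
    simp only [Matrix.mul_assoc]
  have hBA : G - digitalMatrix G M (κ / r) U Λ V * (U * Λ * Vᴴ) =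
      W * (singMatrix G - singMatrix G * (Λᴴ * E * Λ)) * Vᴴ := by
    rw [hB, Matrix.mul_sub, Matrix.sub_mul]
    refine (congrArg (· - _) hG).trans ?_
    congr 1
    have : Uᴴ * (U * Λ * Vᴴ) = Λ * Vᴴ := by
      rw [← Matrix.mul_assoc, ← Matrix.mul_assoc, hUU, Matrix.one_mul]
    rw [Matrix.mul_assoc _ Uᴴ, this]
    simp only [Matrix.mul_assoc]
  -- The Wiener gain of direction `k`; directions without a quantizer are lost.
  set t : ℕ → ℝ := fun k => if k < p then φ k / (φ k + 1) else 0 with ht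
  have hLEL : Λᴴ * E * Λ = Matrix.diagonal fun j : Fin L => ((t j : ℝ) : ℂ) := by
    ext j j'
    rw [Matrix.mul_apply]
    simp only [hE, Matrix.mul_diagonal, Matrix.conjTranspose_apply]
    by_cases hj : j = j'
    · subst hj
      rw [Matrix.diagonal_apply_eq]
      have hterm : ∀ i, star (Λ i j) * ((1 / (s * (φ i + 1)) : ℝ) : ℂ) * Λ i j =
          ((if (i : ℕ) = j then φ i / (φ i + 1) else 0 : ℝ) : ℂ) := fun i => by
        have e : star (Λ i j) * Λ i j = ((‖Λ i j‖ ^ 2 : ℝ) : ℂ) := by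
          rw [Complex.star_def, mul_comm, Complex.mul_conj, Complex.normSq_eq_norm_sq]
        rw [mul_right_comm, e, h.norm_sq hs.le, ← Complex.ofReal_mul]
        congr 1
        split_ifs
        · have := hφ0 i
          change s * φ i * _ = _
          field_simp
        · simp
      simp only [hterm, ← Complex.ofReal_sum]
      congr 1
      by_cases hjp : (j : ℕ) < p
      · rw [Finset.sum_eq_single ⟨j, hjp⟩]
        · simp [ht, hjp]
        · intro i _ hi
          rw [if_neg fun h' => hi (Fin.ext h')]
        · simp
      · simp only [ht, if_neg hjp]
        exact Finset.sum_eq_zero fun i _ => if_neg (by have := i.isLt; omega)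
    · rw [Matrix.diagonal_apply_ne _ hj]
      refine Finset.sum_eq_zero fun i _ => ?_
      by_cases hij : (i : ℕ) = j
      · rw [h.off_diag i j' fun h' => hj (Fin.ext (hij.symm.trans h'))]; simp
      · rw [h.off_diag i j hij]; simp
  have hf1 : frobSq (singMatrix G - singMatrix G * (Λᴴ * E * Λ)) =
      ∑ k : Fin K, singVal G k ^ 2 * (1 - t k) ^ 2 := by
    rw [hLEL]
    refine Finset.sum_congr rfl fun k _ => ?_
    have hterm : ∀ j : Fin L, ‖(singMatrix G - singMatrix G *
        Matrix.diagonal fun j : Fin L => ((t j : ℝ) : ℂ)) k j‖ ^ 2 =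
        if (k : ℕ) = j then singVal G k ^ 2 * (1 - t k) ^ 2 else 0 := fun j => by
      rw [Matrix.sub_apply, Matrix.mul_diagonal, singMatrix, Matrix.of_apply]
      split_ifs with hkj
      · rw [← mul_one_sub, ← hkj, ← Complex.ofReal_one, ← Complex.ofReal_sub, ← Complex.ofReal_mul,
          Complex.norm_real, Real.norm_eq_abs, sq_abs, mul_pow]
      · simp
    simp only [hterm]
    rw [Finset.sum_eq_single (Fin.castLE hKL k)]
    · simp
    · intro j _ hj
      rw [if_neg fun h' => hj (Fin.ext h'.symm)]
    · simp
  have hf2 : frobSq (singMatrix G * Λᴴ * E) =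
      ∑ k : Fin K, if (k : ℕ) < p then singVal G k ^ 2 * (φ k / (s * (φ k + 1) ^ 2)) else 0 := by
    refine Finset.sum_congr rfl fun k _ => ?_
    have hterm : ∀ i : Fin p, ‖(singMatrix G * Λᴴ * E) k i‖ ^ 2 =
        if (k : ℕ) = i then singVal G k ^ 2 * (φ k / (s * (φ k + 1) ^ 2)) else 0 := fun i => by
      rw [hE, Matrix.mul_diagonal, Matrix.mul_apply, Finset.sum_eq_single (Fin.castLE hKL k)]
      · simp only [singMatrix, Matrix.of_apply, Fin.val_castLE, if_true,
          Matrix.conjTranspose_apply, norm_mul, mul_pow, norm_star, h.norm_sq hs.le,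
          Complex.norm_real, Real.norm_eq_abs, sq_abs]
        by_cases hki : (k : ℕ) = i
        · rw [if_pos hki, if_pos hki.symm, ← hki]
          have := hφ0 k
          change _ * (s * φ k) * _ = _
          field_simp
        · rw [if_neg hki, if_neg (Ne.symm hki)]; simp
      · intro j _ hj
        rw [singMatrix, Matrix.of_apply, if_neg fun h' => hj (Fin.ext h'.symm), zero_mul]
      · simp
    simp only [hterm]
    split_ifs with hkp
    · rw [Finset.sum_eq_single ⟨k, hkp⟩]
      · simp
      · intro i _ hi
        rw [if_neg fun h' => hi (Fin.ext h'.symm)]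
      · simp
    · exact Finset.sum_eq_zero fun i _ => if_neg (by have := i.isLt; omega)
  rw [hBA, hB, frobSq_mul_unitary _ (conjTranspose_mem_unitaryGroup hV), frobSq_unitary_mul _ hW,
    frobSq_mul_unitary _ (conjTranspose_mem_unitaryGroup h.unitary), frobSq_unitary_mul _ hW, hf1,
    hf2, hnp, Finset.mul_sum, ← Finset.sum_add_distrib]
  -- Bias `σ²/(φ+1)²` plus noise `σ²φ/(φ+1)²` equals `σ²/(φ+1)`.
  have hterm : ∀ k : ℕ, singVal G k ^ 2 * (1 - t k) ^ 2 + s * (if k < p then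
      singVal G k ^ 2 * (φ k / (s * (φ k + 1) ^ 2)) else 0) =
      if k < p then singVal G k ^ 2 / (φ k + 1) else singVal G k ^ 2 := fun k => by
    have := hφ0 k
    simp only [ht]
    split_ifs
    · field_simp
      ring
    · ring
  simp only [hterm]
  rw [Fin.sum_univ_eq_sum_range (fun k => if k < p then singVal G k ^ 2 / (φ k + 1) else
    singVal G k ^ 2), Finset.sum_ite, waterCost]
  congr 1
  · refine Finset.sum_congr ?_ fun _ _ => rfl
    ext i; simp
  · refine Finset.sum_congr ?_ fun _ _ => rfl
    ext i; simp [and_comm]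

/-- If all entries of `U` have squared modulus `1/p`, then `U D Uᴴ` has constant diagonal `Tr D / p`
for every diagonal `D`; the Fourier matrix qualifies. -/
theorem exists_isDesign (hKL : K ≤ L) (hp : 0 < p) (G : Matrix (Fin K) (Fin L) ℂ) {κ r : ℝ} (M : ℕ)
    (ζ : ℝ) (hκ : 0 ≤ κ) (hr : 0 ≤ r) :
    ∃ (U : Matrix (Fin p) (Fin p) ℂ) (Λ : Matrix (Fin p) (Fin L) ℂ)
      (V : Matrix (Fin L) (Fin L) ℂ), IsDesign G κ M r ζ U Λ V := by
  obtain ⟨V, hV⟩ := exists_isRightSingular hKL G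
  obtain ⟨U, hU, hUn⟩ := exists_unitary_norm_eq p hp
  refine ⟨U, Matrix.of fun i j => if (i : ℕ) = j then
    ((Real.sqrt (4 * κ / (3 * (M : ℝ) ^ 2 * r) * phi (ζ * singVal G i)) : ℝ) : ℂ) else 0, V,
    hV, fun i j hij => if_neg hij, fun i j hij => ?_, hU, fun i j => ?_⟩
  · rw [Matrix.of_apply, if_pos hij, ← Complex.ofReal_pow, Real.sq_sqrt]
    have := phi_nonneg (ζ * singVal G i)
    positivity
  · set Λ : Matrix (Fin p) (Fin L) ℂ := Matrix.of fun i j => if (i : ℕ) = j then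
      ((Real.sqrt (4 * κ / (3 * (M : ℝ) ^ 2 * r) * phi (ζ * singVal G i)) : ℝ) : ℂ) else 0 with hΛ
    have key : ∀ i, (U * Λ * Λᴴ * Uᴴ) i i = ((∑ j : Fin L, (1 / p) *
        ∑ k : Fin p, ‖Λ k j‖ ^ 2 : ℝ) : ℂ) := fun i => by
      have h1 : U * Λ * Λᴴ * Uᴴ = (U * Λ) * (U * Λ)ᴴ := by
        rw [Matrix.conjTranspose_mul, Matrix.mul_assoc]
      rw [h1, mul_conjTranspose_apply_self]
      congr 1
      refine Finset.sum_congr rfl fun j _ => ?_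
      rw [Matrix.mul_apply]
      by_cases hj : (j : ℕ) < p
      · have h0 : ∀ k : Fin p, k ≠ ⟨j, hj⟩ → Λ k j = 0 := fun k hk => by
          rw [hΛ, Matrix.of_apply, if_neg fun h' => hk (Fin.ext h')]
        rw [Finset.sum_eq_single ⟨j, hj⟩ (fun k _ hk => by rw [h0 k hk, mul_zero]) (by simp),
          Finset.sum_eq_single ⟨j, hj⟩ (fun k _ hk => by rw [h0 k hk]; simp) (by simp), norm_mul,
          mul_pow, hUn]
      · have h0 : ∀ k : Fin p, Λ k j = 0 := fun k => by
          rw [hΛ, Matrix.of_apply, if_neg fun h' => hj (by rw [← h']; exact k.isLt)]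
        simp [h0]
    rw [key i, key j]

end Design

/-! ### Dithered quantizers -/

section Quantizer

lemma measurable_uniformQuantizer (M : ℕ) (γ : ℝ) : Measurable (uniformQuantizer M γ) := by
  unfold uniformQuantizer
  refine Measurable.ite (measurableSet_lt measurable_const measurable_norm) ?_ ?_
  · refine Measurable.mul ?_ measurable_const
    have h : (fun x : ℝ => ((SignType.sign x : SignType) : ℝ)) =
        fun x => if 0 < x then 1 else if x < 0 then -1 else 0 := by
      ext x
      rw [sign_apply]
      split_ifs <;> simp
    rw [h]
    exact Measurable.ite measurableSet_Ioi measurable_const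
      (Measurable.ite measurableSet_Iio measurable_const measurable_const)
  · refine measurable_const.add (measurable_const.mul (Measurable.add ?_ measurable_const))
    refine Measurable.comp (g := fun n : ℕ => ((min n (M - 1) : ℕ) : ℝ)) (measurable_of_countable _)
      (Nat.measurable_floor.comp (by fun_prop))

/-- A crude bound whose only purpose is square-integrability of the quantizer error. -/
lemma abs_uniformQuantizer_le {M : ℕ} {γ : ℝ} (hγ : 0 ≤ γ) (x : ℝ) :
    |uniformQuantizer M γ x| ≤ γ + 2 * γ / M * (M + 1 / 2) := by
  have hΔ : 0 ≤ 2 * γ / M := by positivity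
  unfold uniformQuantizer
  set Δ := 2 * γ / M
  have hM : Δ / 2 ≤ Δ * ((M : ℝ) + 1 / 2) := by
    have : (0 : ℝ) ≤ Δ * M := by positivity
    linarith
  split_ifs with h
  · rw [abs_mul]
    have h1 : |((SignType.sign x : SignType) : ℝ)| ≤ 1 := by
      rcases SignType.sign x with _ | _ | _ <;> simp
    have h2 : |γ - Δ / 2| ≤ γ + Δ * (M + 1 / 2) := by
      rw [abs_le]; constructor <;> linarith
    calc _ ≤ 1 * |γ - Δ / 2| := by gcongr
      _ ≤ _ := by rwa [one_mul]
  · have h1 : ((min ⌊(x + γ) / Δ⌋₊ (M - 1) : ℕ) : ℝ) ≤ M := by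
      exact_mod_cast (min_le_right _ _).trans (Nat.sub_le _ _)
    have h2 : Δ * (((min ⌊(x + γ) / Δ⌋₊ (M - 1) : ℕ) : ℝ) + 1 / 2) ≤ Δ * (M + 1 / 2) := by gcongr
    have h3 : 0 ≤ Δ * (((min ⌊(x + γ) / Δ⌋₊ (M - 1) : ℕ) : ℝ) + 1 / 2) := by positivity
    rw [abs_le]
    constructor <;> linarith

lemma integral_fract_add_one (a : ℝ) : ∫ v in a..a + 1, Int.fract v = 1 / 2 := by
  have hper : Function.Periodic (Int.fract : ℝ → ℝ) 1 := fun x => Int.fract_add_one x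
  rw [hper.intervalIntegral_add_eq a 0, zero_add]
  have h : ∫ v in (0 : ℝ)..1, Int.fract v = ∫ v in (0 : ℝ)..1, v :=
    intervalIntegral.integral_congr_Ioo_of_le zero_le_one fun v hv =>
      Int.fract_eq_self.mpr ⟨hv.1.le, hv.2⟩
  rw [h, integral_id]; norm_num

/-- Averaged over the dither, the quantizer is unbiased inside its support. -/
lemma integral_quantizer_error {M : ℕ} (hM : 0 < M) {γ : ℝ} (hγ : 0 < γ) {x : ℝ}
    (hx : |x| + γ / M ≤ γ) :
    ∫ t in (-(γ / M))..(γ / M), (uniformQuantizer M γ (x + t) - x) = 0 := by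
  have hM' : (0 : ℝ) < M := by exact_mod_cast hM
  have hδ : 0 < γ / M := by positivity
  set δ := γ / M with hδdef
  have hΔ : 2 * γ / M = 2 * δ := by rw [hδdef]; ring
  have hMδ : M * δ = γ := by rw [hδdef]; field_simp
  have hxl := neg_abs_le x
  have hxu := le_abs_self x
  -- With spacing `2δ`, rounding to cell midpoints is a sawtooth, and the dither interval is one
  -- full period of it. The open interval keeps `v < M`, so the clipping by `min` is inactive.
  have key : Set.EqOn (fun t => uniformQuantizer M γ (x + t) - x)
      (fun t => t + δ - 2 * δ * Int.fract ((x + γ) / (2 * δ) + t / (2 * δ)))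
      (Set.Ioo (-δ) δ) := fun t ht => by
    have h1 : ¬ γ < |x + t| := by
      rw [not_lt, abs_le]
      constructor <;> linarith [ht.1, ht.2]
    set v := (x + γ) / (2 * δ) + t / (2 * δ) with hv
    have hv' : (x + t + γ) / (2 * δ) = v := by rw [hv]; ring
    have hv0 : 0 ≤ v := by rw [← hv']; exact div_nonneg (by linarith [ht.1]) (by linarith)
    have hvM : v < M := by
      rw [← hv', div_lt_iff₀ (by linarith)]
      linarith [ht.2]
    have hmin : min ⌊v⌋₊ (M - 1) = ⌊v⌋₊ := by
      have := (Nat.floor_lt hv0).mpr hvM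
      omega
    have hfl : (⌊v⌋₊ : ℝ) = v - Int.fract v := by
      rw [natCast_floor_eq_intCast_floor hv0, Int.fract]; ring
    have hvx : 2 * δ * v = x + t + γ := by rw [← hv']; field_simp
    simp only [uniformQuantizer, if_neg h1, hΔ, hv', hmin, hfl]
    linear_combination hvx
  have hfm : ∀ a b : ℝ, IntervalIntegrable (fun t => 2 * δ *
      Int.fract ((x + γ) / (2 * δ) + t / (2 * δ))) volume a b := fun a b => by
    refine IntervalIntegrable.const_mul ?_ _
    refine (intervalIntegrable_const (c := (1 : ℝ))).mono_fun
      (measurable_fract.comp (by fun_prop)).aestronglyMeasurable (Eventually.of_forall fun t => ?_)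
    have h1 : ‖Int.fract ((x + γ) / (2 * δ) + t / (2 * δ))‖ ≤ 1 := by
      rw [Real.norm_eq_abs, abs_of_nonneg (Int.fract_nonneg _)]
      exact (Int.fract_lt_one _).le
    simpa using h1
  rw [intervalIntegral.integral_congr_Ioo_of_le (by linarith) key,
    intervalIntegral.integral_sub
      (Continuous.intervalIntegrable (by fun_prop) _ _) (hfm _ _),
    intervalIntegral.integral_const_mul,
    intervalIntegral.integral_comp_add_div (fun v => Int.fract v) (by positivity : (2 * δ) ≠ 0)]
  have hend : (x + γ) / (2 * δ) + δ / (2 * δ) =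
      (x + γ) / (2 * δ) + -δ / (2 * δ) + 1 := by field_simp; ring
  rw [hend, integral_fract_add_one, intervalIntegral.integral_add
      (Continuous.intervalIntegrable (by fun_prop) _ _)
      (Continuous.intervalIntegrable (by fun_prop) _ _),
    integral_id, intervalIntegral.integral_const]
  simp only [smul_eq_mul]
  ring

/-- By continuity in `t`, absence of overload for almost every dither value extends to the endpoints
`±γ/M`, which yields the pointwise condition on `x`. -/
lemma integral_quantizer_error_cond {M : ℕ} (hM : 0 < M) {γ : ℝ} (hγ : 0 < γ) {x : ℝ}
    (hx : ∀ᵐ t ∂(cond volume (Set.Icc (-(γ / M)) (γ / M))), |x + t| ≤ γ) :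
    ∫ t, (uniformQuantizer M γ (x + t) - x) ∂(cond volume (Set.Icc (-(γ / M)) (γ / M))) = 0 := by
  have hM' : (0 : ℝ) < M := by exact_mod_cast hM
  have hδ : 0 < γ / M := by positivity
  set δ := γ / M with hδdef
  have hx2 : ∀ᵐ t ∂(volume.restrict (Set.Icc (-δ) δ)), |x + t| ≤ γ := by
    unfold ProbabilityTheory.cond at hx
    rwa [Measure.ae_ennreal_smul_measure_iff] at hx
    rw [ENNReal.inv_ne_zero, Real.volume_Icc]
    exact ENNReal.ofReal_ne_top
  have hall : Set.EqOn (fun t => max |x + t| γ) (fun _ => γ) (Set.Icc (-δ) δ) := by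
    refine Measure.eqOn_Icc_of_ae_eq volume (by linarith) ?_ (by fun_prop) (by fun_prop)
    filter_upwards [hx2] with t ht using max_eq_right ht
  have h1 : |x + δ| ≤ γ := max_eq_right_iff.mp (hall ⟨by linarith, le_rfl⟩)
  have h2 : |x + -δ| ≤ γ := max_eq_right_iff.mp (hall ⟨le_rfl, by linarith⟩)
  rw [abs_le] at h1 h2
  have h3 : |x| + δ ≤ γ := by
    rcases abs_cases x with ⟨h, _⟩ | ⟨h, _⟩ <;> rw [h] <;> linarith
  unfold ProbabilityTheory.cond
  rw [integral_smul_measure, integral_Icc_eq_integral_Ioc,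
    ← intervalIntegral.integral_of_le (by linarith), integral_quantizer_error hM hγ h3, smul_zero]

variable {Ω W : Type*} [MeasurableSpace Ω] [MeasurableSpace W] {P : Measure Ω}
  [IsProbabilityMeasure P]

/-- The error of a dithered quantizer inside its support is uncorrelated with everything that is
independent of the dither. -/
lemma integral_quantizer_error_mul {M : ℕ} (hM : 0 < M) {γ : ℝ} (hγ : 0 < γ) {X : Ω → W}
    (hX : Measurable X) {T : Ω → ℝ} (hT : Measurable T)
    (hunif : pdf.IsUniform T (Set.Icc (-(γ / M)) (γ / M)) P volume) (hind : IndepFun X T P)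
    {S : W → ℝ} (hS : Measurable S) {h : W → ℂ} (hh : Measurable h)
    (hin : ∀ᵐ ω ∂P, |S (X ω) + T ω| ≤ γ)
    (hint : Integrable (fun ω => ((uniformQuantizer M γ (S (X ω) + T ω) - S (X ω) : ℝ) : ℂ) *
      h (X ω)) P) :
    ∫ ω, ((uniformQuantizer M γ (S (X ω) + T ω) - S (X ω) : ℝ) : ℂ) * h (X ω) ∂P = 0 := by
  set F : W × ℝ → ℂ := fun p => ((uniformQuantizer M γ (S p.1 + p.2) - S p.1 : ℝ) : ℂ) * h p.1
    with hF
  have hFm : Measurable F := by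
    refine Measurable.mul (Complex.measurable_ofReal.comp (Measurable.sub
      ((measurable_uniformQuantizer M γ).comp ?_) ?_)) (hh.comp measurable_fst)
    · exact (hS.comp measurable_fst).add measurable_snd
    · exact hS.comp measurable_fst
  have hXT : Measurable fun ω => (X ω, T ω) := hX.prodMk hT
  have hmap : P.map (fun ω => (X ω, T ω)) = (P.map X).prod (P.map T) :=
    hind.map_prod_eq_prod_map_map hX.aemeasurable hT.aemeasurable
  have hPX : IsProbabilityMeasure (P.map X) := Measure.isProbabilityMeasure_map hX.aemeasurable
  have hPT : IsProbabilityMeasure (P.map T) := Measure.isProbabilityMeasure_map hT.aemeasurable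
  have hset : MeasurableSet {p : W × ℝ | |S p.1 + p.2| ≤ γ} :=
    measurableSet_le ((hS.comp measurable_fst).add measurable_snd).abs measurable_const
  have hin2 : ∀ᵐ p ∂(P.map X).prod (P.map T), |S p.1 + p.2| ≤ γ := by
    rw [← hmap, ae_map_iff hXT.aemeasurable hset]
    exact hin
  have hintF : Integrable F ((P.map X).prod (P.map T)) := by
    rw [← hmap, integrable_map_measure hFm.aestronglyMeasurable hXT.aemeasurable]
    exact hint
  -- Fubini for the joint law: the inner integral over the dither vanishes for almost every value of
  -- `X`.
  calc _ = ∫ p, F p ∂(P.map fun ω => (X ω, T ω)) :=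
        (integral_map hXT.aemeasurable hFm.aestronglyMeasurable).symm
    _ = ∫ w, ∫ t, F (w, t) ∂(P.map T) ∂(P.map X) := by rw [hmap, integral_prod _ hintF]
    _ = ∫ w, 0 ∂(P.map X) := by
        refine integral_congr_ae ?_
        filter_upwards [Measure.ae_ae_of_ae_prod hin2] with w hw
        simp only [hF]
        rw [integral_mul_const, integral_complex_ofReal]
        rw [hunif] at hw ⊢
        rw [integral_quantizer_error_cond hM hγ hw]; simp
    _ = 0 := by simp

/-- Independence of a pair from the last one of three variables. -/
lemma indepFun_prodMk_of_indepFun {α β δ : Type*} [MeasurableSpace α] [MeasurableSpace β]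
    [MeasurableSpace δ] {X : Ω → α} {Y : Ω → β} {Z : Ω → δ} (hX : Measurable X) (hY : Measurable Y)
    (hZ : Measurable Z) (h1 : IndepFun X (fun ω => (Y ω, Z ω)) P) (h2 : IndepFun Y Z P) :
    IndepFun (fun ω => (X ω, Y ω)) Z P := by
  have hPX : IsProbabilityMeasure (P.map X) := Measure.isProbabilityMeasure_map hX.aemeasurable
  have hPY : IsProbabilityMeasure (P.map Y) := Measure.isProbabilityMeasure_map hY.aemeasurable
  have hPZ : IsProbabilityMeasure (P.map Z) := Measure.isProbabilityMeasure_map hZ.aemeasurable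
  have h3 : IndepFun X Y P := h1.comp measurable_id measurable_fst
  rw [indepFun_iff_map_prod_eq_prod_map_map (hX.prodMk hY).aemeasurable hZ.aemeasurable]
  apply MeasurableEquiv.prodAssoc.map_measurableEquiv_injective
  rw [h3.map_prod_eq_prod_map_map hX.aemeasurable hY.aemeasurable, Measure.prodAssoc_prod,
    ← h2.map_prod_eq_prod_map_map hY.aemeasurable hZ.aemeasurable,
    ← h1.map_prod_eq_prod_map_map hX.aemeasurable (hY.prodMk hZ).aemeasurable,
    Measure.map_map MeasurableEquiv.prodAssoc.measurable ((hX.prodMk hY).prodMk hZ)]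
  rfl

lemma ditheredOutput_sub {Ω : Type*} {ι : Type*} (M : ℕ) (γ : ℝ) (s z : Ω → ι → ℂ) (ω : Ω) (l : ι) :
    ditheredOutput M γ s z ω l - s ω l =
      ((uniformQuantizer M γ ((s ω l).re + (z ω l).re) - (s ω l).re : ℝ) : ℂ) +
      Complex.I * ((uniformQuantizer M γ ((s ω l).im + (z ω l).im) - (s ω l).im : ℝ) : ℂ) := by
  unfold ditheredOutput
  conv_lhs => rw [← Complex.re_add_im (s ω l)]
  simp only [Complex.add_re, Complex.add_im, Complex.mul_re, Complex.mul_im, Complex.ofReal_re,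
    Complex.ofReal_im, Complex.I_re, Complex.I_im]
  push_cast
  ring_nf

lemma memLp_quantizer_error {M : ℕ} {γ : ℝ} (hγ : 0 ≤ γ) {s t : Ω → ℝ} (hs : MemLp s 2 P)
    (ht : AEMeasurable t P) :
    MemLp (fun ω => ((uniformQuantizer M γ (s ω + t ω) - s ω : ℝ) : ℂ)) 2 P := by
  have h1 : MemLp (fun ω => uniformQuantizer M γ (s ω + t ω)) 2 P :=
    MemLp.of_bound (((measurable_uniformQuantizer M γ).comp_aemeasurable
      (hs.1.aemeasurable.add ht)).aestronglyMeasurable) (γ + 2 * γ / M * (M + 1 / 2))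
      (Eventually.of_forall fun ω => abs_uniformQuantizer_le hγ _)
  exact (h1.sub hs).ofReal

/-- The complex version of `integral_quantizer_error_mul`. -/
lemma integral_ditheredOutput_sub_mul {ι : Type*} {M : ℕ} (hM : 0 < M) {γ : ℝ} (hγ : 0 < γ)
    {s z : Ω → ι → ℂ} {l : ι} (hz : Measurable fun ω => z ω l)
    (hre : pdf.IsUniform (fun ω => (z ω l).re) (Set.Icc (-(γ / M)) (γ / M)) P volume)
    (him : pdf.IsUniform (fun ω => (z ω l).im) (Set.Icc (-(γ / M)) (γ / M)) P volume)
    (hin : NoOverload P γ s z) (hs : MemLp (fun ω => s ω l) 2 P)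
    {X : Ω → W} (hX : Measurable X) (hXre : IndepFun X (fun ω => (z ω l).re) P)
    (hXim : IndepFun X (fun ω => (z ω l).im) P) {S : W → ℂ} (hS : Measurable S)
    (hSX : ∀ ω, s ω l = S (X ω)) {h : W → ℂ} (hh : Measurable h)
    (hhX : MemLp (fun ω => h (X ω)) 2 P) :
    ∫ ω, (ditheredOutput M γ s z ω l - s ω l) * h (X ω) ∂P = 0 := by
  have mre := memLp_quantizer_error (M := M) hγ.le hs.re (Complex.measurable_re.comp hz).aemeasurable
  have mim := memLp_quantizer_error (M := M) hγ.le hs.im (Complex.measurable_im.comp hz).aemeasurable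
  have ire : Integrable (fun ω => ((uniformQuantizer M γ ((s ω l).re + (z ω l).re) -
      (s ω l).re : ℝ) : ℂ) * h (X ω)) P := mre.integrable_mul hhX
  have iim : Integrable (fun ω => ((uniformQuantizer M γ ((s ω l).im + (z ω l).im) -
      (s ω l).im : ℝ) : ℂ) * h (X ω)) P := mim.integrable_mul hhX
  have h1 := integral_quantizer_error_mul hM hγ hX (Complex.measurable_re.comp hz) hre hXre
    (Complex.measurable_re.comp hS) hh (by
      filter_upwards [hin] with ω hω
      have := (hω l).1
      rwa [hSX ω] at this) (by
      refine ire.congr (Eventually.of_forall fun ω => ?_)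
      simp [hSX])
  have h2 := integral_quantizer_error_mul hM hγ hX (Complex.measurable_im.comp hz) him hXim
    (Complex.measurable_im.comp hS) hh (by
      filter_upwards [hin] with ω hω
      have := (hω l).2
      rwa [hSX ω] at this) (by
      refine iim.congr (Eventually.of_forall fun ω => ?_)
      simp [hSX])
  have h3 : ∀ ω, (ditheredOutput M γ s z ω l - s ω l) * h (X ω) =
      ((uniformQuantizer M γ ((s ω l).re + (z ω l).re) - (s ω l).re : ℝ) : ℂ) * h (X ω) +
      Complex.I * (((uniformQuantizer M γ ((s ω l).im + (z ω l).im) - (s ω l).im : ℝ) : ℂ) *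
        h (X ω)) := fun ω => by
    rw [ditheredOutput_sub]; ring
  simp_rw [h3]
  rw [integral_add ire (iim.const_mul _), integral_const_mul]
  simp only [hSX]
  refine (congrArg₂ (fun u v => u + Complex.I * v) h1 h2).trans ?_
  simp

end Quantizer

/-- Dithered uniform quantizers that are not overloaded and whose errors have the nominal power add
uncorrelated white noise to their inputs. -/
theorem isAdditiveWhite_ditheredOutput {Ω : Type*} [MeasurableSpace Ω] {P : Measure Ω}
    [IsProbabilityMeasure P] {ι α β : Type*} [DecidableEq ι] [Fintype α] {M : ℕ} (hM : 0 < M)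
    {γ : ℝ} (hγ0 : 0 ≤ γ) {Y : Ω → α → ℂ} {G : Ω → β → ℂ} (hY : Measurable Y) (hG : Measurable G)
    (hYL : ∀ a, MemLp (fun ω => Y ω a) 2 P) (hGL : ∀ b, MemLp (fun ω => G ω b) 2 P)
    (A : Matrix ι α ℂ) {z : Ω → ι → ℂ} (hz : IsDither P M γ (fun ω => (Y ω, G ω)) z)
    (hin : NoOverload P γ (fun ω => A *ᵥ Y ω) z) {σsq : ℝ}
    (hpow : ∀ l, ∫ ω, ‖ditheredOutput M γ (fun ω => A *ᵥ Y ω) z ω l - (A *ᵥ Y ω) l‖ ^ 2 ∂P = σsq) :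
    IsAdditiveWhite P σsq Y G (fun ω => A *ᵥ Y ω)
      (ditheredOutput M γ (fun ω => A *ᵥ Y ω) z) := by
  -- For `γ = 0` the dither interval is a null set and conditioning on it gives the zero measure,
  -- which is no law. Without quantizers there is no dither, hence the argument in `ι`.
  have hγ : ι → 0 < γ := fun l => by
    refine lt_of_le_of_ne hγ0 fun h0 => ?_
    have h1 := hz.uniform_re l
    have hm : Measurable fun ω => (z ω l).re := Complex.measurable_re.comp (hz.measurable l)
    have h2 := Measure.isProbabilityMeasure_map (μ := P) hm.aemeasurable
    rw [pdf.IsUniform, ← h0] at h1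
    have h3 : P.map (fun ω => (z ω l).re) Set.univ = 0 := by
      rw [h1, ProbabilityTheory.cond]; simp
    rw [measure_univ] at h3
    exact one_ne_zero h3
  set s : Ω → ι → ℂ := fun ω => A *ᵥ Y ω with hs
  have hzm : Measurable z := measurable_pi_lambda _ hz.measurable
  have hsL : ∀ l, MemLp (fun ω => s ω l) 2 P := fun l =>
    memLp_finsetSum Finset.univ fun a _ => (hYL a).const_mul (A l a)
  have hSm : ∀ l, Measurable fun w : (α → ℂ) × (β → ℂ) => (A *ᵥ w.1) l := fun l =>
    Finset.measurable_sum _ fun a _ =>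
      measurable_const.mul ((measurable_pi_apply a).comp measurable_fst)
  have hXm : Measurable fun ω => (Y ω, G ω) := hY.prodMk hG
  have hcomp : ∀ {δ : Type} [MeasurableSpace δ] {f : (ι → ℂ) → δ}, Measurable f →
      IndepFun (fun ω => (Y ω, G ω)) (fun ω => f (z ω)) P := fun hf =>
    hz.indep_signal.symm.comp measurable_id hf
  have hre : ∀ l, Measurable fun u : ι → ℂ => (u l).re := fun l =>
    Complex.measurable_re.comp (measurable_pi_apply l)
  have him : ∀ l, Measurable fun u : ι → ℂ => (u l).im := fun l =>
    Complex.measurable_im.comp (measurable_pi_apply l)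
  have horth : ∀ l {h : (α → ℂ) × (β → ℂ) → ℂ}, Measurable h →
      MemLp (fun ω => h (Y ω, G ω)) 2 P →
      ∫ ω, (ditheredOutput M γ s z ω l - s ω l) * h (Y ω, G ω) ∂P = 0 := fun l h hh hhL =>
    integral_ditheredOutput_sub_mul hM (hγ l) (hz.measurable l) (hz.uniform_re l) (hz.uniform_im l)
      hin (hsL l) hXm (hcomp (hre l)) (hcomp (him l)) (hSm l) (fun _ => rfl) hh hhL
  have hEL : ∀ l, MemLp (fun ω => ditheredOutput M γ s z ω l - s ω l) 2 P := fun l => by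
    simp_rw [ditheredOutput_sub]
    exact (memLp_quantizer_error hγ0 (hsL l).re
      (Complex.measurable_re.comp (hz.measurable l)).aemeasurable).add
      ((memLp_quantizer_error hγ0 (hsL l).im
        (Complex.measurable_im.comp (hz.measurable l)).aemeasurable).const_mul Complex.I)
  refine ⟨hEL, fun l => ?_, fun l a => ?_, fun l b => ?_, fun l l' => ?_⟩
  · have := horth l (h := fun _ => 1) measurable_const (memLp_const 1)
    simpa using this
  · exact horth l (h := fun w => star (w.1 a)) (by fun_prop) (hYL a).star
  · exact horth l (h := fun w => star (w.2 b)) (by fun_prop) (hGL b).star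
  · split_ifs with hll
    · subst hll
      rw [← hpow l, ← integral_complex_ofReal]
      refine integral_congr_ae (Eventually.of_forall fun ω => ?_)
      simp only [Complex.star_def, Complex.mul_conj, Complex.normSq_eq_norm_sq]
      rfl
    -- The error at `l'` is a function of the signals and `z l'`, and that pair is independent of
    -- each of the two real dithers at `l`.
    · have hcm : ∀ a : ι × Bool, Measurable fun ω => if a.2 then (z ω a.1).re else (z ω a.1).im :=
        fun a => by
          rcases a with ⟨i, b⟩
          cases b
          · exact (him i).comp hzm
          · exact (hre i).comp hzm
      have hpair : ∀ b : Bool, IndepFun (fun ω => z ω l')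
          (fun ω => if b then (z ω l).re else (z ω l).im) P := fun b => by
        have h1 := hz.indep.indepFun_prodMk hcm (l', true) (l', false) (l, b)
          (fun h => hll (congrArg Prod.fst h).symm) (fun h => hll (congrArg Prod.fst h).symm)
        have h2 := h1.comp (φ := fun u : ℝ × ℝ => (u.1 : ℂ) + u.2 * Complex.I) (ψ := id)
          (by fun_prop) measurable_id
        have h3 : (fun ω => z ω l') = fun ω => ((z ω l').re : ℂ) + (z ω l').im * Complex.I :=
          funext fun ω => (Complex.re_add_im (z ω l')).symm
        rw [h3]
        exact h2
      have hXre : IndepFun (fun ω => ((Y ω, G ω), z ω l')) (fun ω => (z ω l).re) P :=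
        indepFun_prodMk_of_indepFun hXm (hz.measurable l') ((hre l).comp hzm)
          (hcomp ((measurable_pi_apply l').prodMk (hre l))) (hpair true)
      have hXim : IndepFun (fun ω => ((Y ω, G ω), z ω l')) (fun ω => (z ω l).im) P :=
        indepFun_prodMk_of_indepFun hXm (hz.measurable l') ((him l).comp hzm)
          (hcomp ((measurable_pi_apply l').prodMk (him l))) (hpair false)
      have hQ := measurable_uniformQuantizer M γ
      have hSm' : ∀ k, Measurable fun w : ((α → ℂ) × (β → ℂ)) × ℂ => (A *ᵥ w.1.1) k := fun k =>
        (hSm k).comp measurable_fst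
      have hH : Measurable fun w : ((α → ℂ) × (β → ℂ)) × ℂ =>
          star ((uniformQuantizer M γ ((A *ᵥ w.1.1) l' + w.2).re : ℂ) + Complex.I *
            (uniformQuantizer M γ ((A *ᵥ w.1.1) l' + w.2).im : ℂ) - (A *ᵥ w.1.1) l') := by
        have h1 := (hSm' l').add measurable_snd
        refine continuous_star.measurable.comp (Measurable.sub (Measurable.add ?_ ?_) (hSm' l'))
        · exact Complex.measurable_ofReal.comp (hQ.comp (Complex.measurable_re.comp h1))
        · exact measurable_const.mul
            (Complex.measurable_ofReal.comp (hQ.comp (Complex.measurable_im.comp h1)))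
      exact integral_ditheredOutput_sub_mul hM (hγ l) (hz.measurable l) (hz.uniform_re l)
        (hz.uniform_im l) hin (hsL l) (hXm.prodMk (hz.measurable l')) hXre hXim (hSm' l)
        (fun _ => rfl) hH (hEL l').star

/-! ### Optimality and attainment for hardware-limited systems. -/

section System

variable {Ω : Type*} [MeasurableSpace Ω] {P : Measure Ω} [IsProbabilityMeasure P]
  {K L p : ℕ} {ρ : ℤ → ℝ} {Cg : Matrix (Fin K) (Fin K) ℂ} {Cy : Matrix (Fin L) (Fin L) ℂ}
  {Γ : Matrix (Fin K) (Fin L) ℂ} {g : ℕ → Ω → Fin K → ℂ} {y : ℕ → Ω → Fin L → ℂ}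
  {κ : ℝ} {M : ℕ} {ζ : ℝ}

lemma optimalValue_eq (Cg : Matrix (Fin K) (Fin K) ℂ) (Cy : Matrix (Fin L) (Fin L) ℂ)
    (Γ : Matrix (Fin K) (Fin L) ℂ) (p : ℕ) (ζ : ℝ) :
    optimalValue Cg Cy Γ p ζ =
      mmseValue Cg Cy Γ + waterCost (singVal (gammaTilde Γ Cy)) K p ζ / K := by
  unfold optimalValue waterCost
  ring

/-- No system does better than the optimal value. -/
theorem optimalValue_le_avgMSE (hsource : IsSource P ρ Cg Cy Γ g y)
    (hρ : ∀ τ, ρ τ = if τ = 0 then 1 else 0) (hCy : Cy.PosDef) (hK : 0 < K) (hKL : K ≤ L)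
    (hp : 0 < p) (hκ : 0 < κ) (hM : 0 < M) (hwf : WaterFilling (gammaTilde Γ Cy) p κ M ζ) {N : ℕ}
    (hN : 0 < N) (A : Matrix (Fin p × Fin N) (Fin L × Fin N) ℂ)
    (B : Matrix (Fin K × Fin N) (Fin p × Fin N) ℂ) {q : Ω → Fin p × Fin N → ℂ}
    (hq : IsADCOutput P κ M g y N A q) :
    optimalValue Cg Cy Γ p ζ ≤ avgMSE P g N B q := by
  have hM' : (0 : ℝ) < M := by exact_mod_cast hM
  have hN' : (0 : ℝ) < N := by exact_mod_cast hN
  have hK' : (0 : ℝ) < K := by exact_mod_cast hK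
  have h := waterCost_le hKL hp (gammaTilde Γ Cy) hwf.pos
    (by positivity : 0 < 4 * κ / (3 * (M : ℝ) ^ 2)) hwf.eq_one hN (A * perSample (CFC.sqrt Cy) N) B
  have hsup : noisePower M (supportSq P κ y N A) = 4 * κ / (3 * (M : ℝ) ^ 2) *
      ⨆ l, ∑ j, ‖(A * perSample (CFC.sqrt Cy) N) l j‖ ^ 2 := by
    simp only [noisePower, supportSq, integral_norm_sq_analogOutput hsource hρ hCy]
    ring
  rw [avgMSE_eq hsource hρ hCy hN A B hq, optimalValue_eq, hsup]
  gcongr _ + ?_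
  rw [div_le_div_iff₀ hK' (by positivity)]
  calc _ = N * waterCost (singVal (gammaTilde Γ Cy)) K p ζ * K := by ring
    _ ≤ _ := mul_le_mul_of_nonneg_right h hK'.le

lemma analogMatrix_mul_sqrt (hCy : Cy.PosDef) (U : Matrix (Fin p) (Fin p) ℂ)
    (Λ : Matrix (Fin p) (Fin L) ℂ) (V : Matrix (Fin L) (Fin L) ℂ) :
    analogMatrix Cy U Λ V * CFC.sqrt Cy = U * Λ * Vᴴ := by
  rw [analogMatrix, Matrix.mul_assoc, Matrix.nonsing_inv_mul _ (isUnit_det_sqrt hCy),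
    Matrix.mul_one]

variable {r : ℝ} {U : Matrix (Fin p) (Fin p) ℂ} {Λ : Matrix (Fin p) (Fin L) ℂ}
  {V : Matrix (Fin L) (Fin L) ℂ}

omit [IsProbabilityMeasure P] in
/-- The support of the quantizers in the design. -/
theorem supportSq_design (hsource : IsSource P ρ Cg Cy Γ g y)
    (hρ : ∀ τ, ρ τ = if τ = 0 then 1 else 0) (hCy : Cy.PosDef) (hp : 0 < p) (hpL : p ≤ L)
    (hr : 0 < r) (hκ : 0 < κ) (hwf : WaterFilling (gammaTilde Γ Cy) p κ M ζ)
    (hd : IsDesign (gammaTilde Γ Cy) κ M r ζ U Λ V) {N : ℕ} (hN : 0 < N) :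
    supportSq P κ y N (perSample (analogMatrix Cy U Λ V) N) = κ / r := by
  -- A real supremum over an empty index set would be `0` instead of the common variance.
  have : Nonempty (Fin p × Fin N) := ⟨(⟨0, hp⟩, ⟨0, hN⟩)⟩
  simp only [supportSq, integral_norm_sq_analogOutput hsource hρ hCy, perSample_mul,
    analogMatrix_mul_sqrt hCy, sum_norm_sq_row_perSample, hd.sum_norm_sq_row hpL hp hr hκ hwf]
  rw [ciSup_const]
  ring

/-- The design attains the optimal value. -/
theorem avgMSE_design (hsource : IsSource P ρ Cg Cy Γ g y)
    (hρ : ∀ τ, ρ τ = if τ = 0 then 1 else 0) (hCy : Cy.PosDef) (hKL : K ≤ L) (hp : 0 < p)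
    (hpL : p ≤ L) (hr : 0 < r) (hκ : 0 < κ) (hM : 0 < M)
    (hwf : WaterFilling (gammaTilde Γ Cy) p κ M ζ)
    (hd : IsDesign (gammaTilde Γ Cy) κ M r ζ U Λ V) {N : ℕ} (hN : 0 < N)
    {q : Ω → Fin p × Fin N → ℂ}
    (hq : IsADCOutput P κ M g y N (perSample (analogMatrix Cy U Λ V) N) q) :
    avgMSE P g N (perSample (digitalMatrix (gammaTilde Γ Cy) M (κ / r) U Λ V) N) q =
      optimalValue Cg Cy Γ p ζ := by
  have hN' : (N : ℝ) ≠ 0 := by exact_mod_cast hN.ne'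
  rw [avgMSE_eq hsource hρ hCy hN _ _ hq,
    supportSq_design hsource hρ hCy hp hpL hr hκ hwf hd hN, perSample_mul,
    analogMatrix_mul_sqrt hCy, perSample_mul, ← perSample_sub, frobSq_perSample, frobSq_perSample,
    optimalValue_eq, ← hd.cost_eq hKL hpL hr hκ hM,
    mul_left_comm, ← mul_add, mul_div_mul_left _ _ hN']

end System

end TaskQuant

theorem corollary1 {Ω : Type*} [MeasurableSpace Ω] (P : Measure Ω) [IsProbabilityMeasure P]
    (K L p : ℕ) (hKL : K ≤ L) (hp : 0 < p) (hpL : p ≤ L)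
    (ρ : ℤ → ℝ) (hρ : ∀ τ, ρ τ = if τ = 0 then 1 else 0)
    (Cg : Matrix (Fin K) (Fin K) ℂ) (Cy : Matrix (Fin L) (Fin L) ℂ)
    (Γ : Matrix (Fin K) (Fin L) ℂ) (hCy : Cy.PosDef) (hΓ : Γ ≠ 0)
    (g : ℕ → Ω → Fin K → ℂ) (y : ℕ → Ω → Fin L → ℂ)
    (hsource : TaskQuant.IsSource P ρ Cg Cy Γ g y)
    (R r η κ : ℝ) (M : ℕ)
    (hr : r = TaskQuant.ratio p L) (hM : M = TaskQuant.resolution R r)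
    (hη : 0 < η) (hηM : η < Real.sqrt (3 / 2) * M) (hκ : κ = TaskQuant.kappa η M) :
    -- the water-filling level exists and is unique
    (∃! ζ : ℝ, TaskQuant.WaterFilling (TaskQuant.gammaTilde Γ Cy) p κ M ζ) ∧
    (∀ ζ : ℝ, TaskQuant.WaterFilling (TaskQuant.gammaTilde Γ Cy) p κ M ζ →
      -- no system does better than the optimal value, for any number of samples
      (∀ N : ℕ, 0 < N → ∀ (A : Matrix (Fin p × Fin N) (Fin L × Fin N) ℂ)
        (B : Matrix (Fin K × Fin N) (Fin p × Fin N) ℂ) (q : Ω → Fin p × Fin N → ℂ),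
        TaskQuant.IsADCOutput P κ M g y N A q →
          TaskQuant.optimalValue Cg Cy Γ p ζ ≤ TaskQuant.avgMSE P g N B q) ∧
      -- nor does any sequence of systems in the limit
      (∀ (A : ∀ N : ℕ, Matrix (Fin p × Fin N) (Fin L × Fin N) ℂ)
        (B : ∀ N : ℕ, Matrix (Fin K × Fin N) (Fin p × Fin N) ℂ)
        (q : ∀ N : ℕ, Ω → Fin p × Fin N → ℂ) (m : ℝ),
        (∀ N, TaskQuant.IsADCOutput P κ M g y N (A N) (q N)) →
        Tendsto (fun N => TaskQuant.avgMSE P g N (B N) (q N)) atTop (𝓝 m) →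
          TaskQuant.optimalValue Cg Cy Γ p ζ ≤ m) ∧
      -- the factors of the per-sample design exist
      (∃ (U : Matrix (Fin p) (Fin p) ℂ) (Λ : Matrix (Fin p) (Fin L) ℂ)
        (V : Matrix (Fin L) (Fin L) ℂ),
        TaskQuant.IsDesign (TaskQuant.gammaTilde Γ Cy) κ M r ζ U Λ V) ∧
      -- each such design has the stated support and attains the optimal value
      (∀ (U : Matrix (Fin p) (Fin p) ℂ) (Λ : Matrix (Fin p) (Fin L) ℂ)
        (V : Matrix (Fin L) (Fin L) ℂ),
        TaskQuant.IsDesign (TaskQuant.gammaTilde Γ Cy) κ M r ζ U Λ V →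
        (∀ N : ℕ, 0 < N →
          TaskQuant.supportSq P κ y N
            (TaskQuant.perSample (TaskQuant.analogMatrix Cy U Λ V) N) = κ / r) ∧
        (∀ N : ℕ, 0 < N → ∀ q : Ω → Fin p × Fin N → ℂ,
          TaskQuant.IsADCOutput P κ M g y N
            (TaskQuant.perSample (TaskQuant.analogMatrix Cy U Λ V) N) q →
          TaskQuant.avgMSE P g N (TaskQuant.perSample
            (TaskQuant.digitalMatrix (TaskQuant.gammaTilde Γ Cy) M (κ / r) U Λ V) N) q =
              TaskQuant.optimalValue Cg Cy Γ p ζ) ∧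
        (∀ q : ∀ N : ℕ, Ω → Fin p × Fin N → ℂ,
          (∀ N, TaskQuant.IsADCOutput P κ M g y N
            (TaskQuant.perSample (TaskQuant.analogMatrix Cy U Λ V) N) (q N)) →
          Tendsto (fun N => TaskQuant.avgMSE P g N (TaskQuant.perSample
            (TaskQuant.digitalMatrix (TaskQuant.gammaTilde Γ Cy) M (κ / r) U Λ V) N) (q N))
            atTop (𝓝 (TaskQuant.optimalValue Cg Cy Γ p ζ))))) ∧
    -- dithered uniform quantizers that are not overloaded and whose errors have the nominal power
    -- are ADCs in the above sense
    (∀ (N : ℕ) (A : Matrix (Fin p × Fin N) (Fin L × Fin N) ℂ) (γ : ℝ)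
      (z : Ω → Fin p × Fin N → ℂ),
      0 ≤ γ → γ ^ 2 = TaskQuant.supportSq P κ y N A →
      TaskQuant.IsDither P M γ
        (fun ω => (TaskQuant.stack y N ω, TaskQuant.stack g N ω)) z →
      TaskQuant.NoOverload P γ (TaskQuant.analogOutput y N A) z →
      (∀ l, ∫ ω, ‖TaskQuant.ditheredOutput M γ (TaskQuant.analogOutput y N A) z ω l -
          TaskQuant.analogOutput y N A ω l‖ ^ 2 ∂P = TaskQuant.noisePower M (γ ^ 2)) →
      TaskQuant.IsADCOutput P κ M g y N A
        (TaskQuant.ditheredOutput M γ (TaskQuant.analogOutput y N A) z)) := by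
  have hL : 0 < L := hp.trans_le hpL
  have hr0 : 0 < r := by
    have hp' : (0 : ℝ) < p := by exact_mod_cast hp
    have hL' : (0 : ℝ) < L := by exact_mod_cast hL
    rw [hr, TaskQuant.ratio]
    positivity
  have hM0 : 0 < M := by
    rcases Nat.eq_zero_or_pos M with h | h
    · rw [h, Nat.cast_zero, mul_zero] at hηM
      exact absurd hη hηM.not_gt
    · exact h
  -- The bound on `η` is exactly what makes `1 - 2η²/(3M²)` positive.
  have hκ0 : 0 < κ := by
    have hM' : (0 : ℝ) < M := by exact_mod_cast hM0
    have h1 : η ^ 2 < 3 / 2 * (M : ℝ) ^ 2 := by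
      calc η ^ 2 < (Real.sqrt (3 / 2) * M) ^ 2 := by gcongr
        _ = _ := by rw [mul_pow, Real.sq_sqrt (by norm_num)]
    have h2 : 0 < 1 - 2 * η ^ 2 / (3 * (M : ℝ) ^ 2) := by
      rw [sub_pos, div_lt_one (by positivity)]
      linarith
    rw [hκ, TaskQuant.kappa]
    positivity
  have hK : 0 < K := by
    rcases Nat.eq_zero_or_pos K with h | h
    · subst h
      exact absurd (Subsingleton.elim Γ 0) hΓ
    · exact h
  have hG : TaskQuant.gammaTilde Γ Cy ≠ 0 := fun h => hΓ (by
    have h1 := congrArg (· * (CFC.sqrt Cy)⁻¹) h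
    simpa [TaskQuant.gammaTilde, Matrix.mul_assoc,
      Matrix.mul_nonsing_inv _ (TaskQuant.isUnit_det_sqrt hCy)] using h1)
  refine ⟨TaskQuant.existsUnique_waterFilling hG hp hκ0 hM0, fun ζ hwf => ⟨fun N hN A B q hq => ?_,
    fun A B q m hq hm => ?_, TaskQuant.exists_isDesign hKL hp _ M ζ hκ0.le hr0.le,
    fun U Λ V hd => ⟨fun N hN => ?_, fun N hN q hq => ?_, fun q hq => ?_⟩⟩,
    fun N A γ z hγ hγsq hz hin hpow => ?_⟩
  · exact TaskQuant.optimalValue_le_avgMSE hsource hρ hCy hK hKL hp hκ0 hM0 hwf hN A B hq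
  · refine ge_of_tendsto hm ?_
    filter_upwards [eventually_gt_atTop 0] with N hN
    exact TaskQuant.optimalValue_le_avgMSE hsource hρ hCy hK hKL hp hκ0 hM0 hwf hN _ _ (hq N)
  · exact TaskQuant.supportSq_design hsource hρ hCy hp hpL hr0 hκ0 hwf hd hN
  · exact TaskQuant.avgMSE_design hsource hρ hCy hKL hp hpL hr0 hκ0 hM0 hwf hd hN hq
  · refine tendsto_const_nhds.congr' ?_
    filter_upwards [eventually_gt_atTop 0] with N hN
    exact (TaskQuant.avgMSE_design hsource hρ hCy hKL hp hpL hr0 hκ0 hM0 hwf hd hN (hq N)).symm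
  · unfold TaskQuant.IsADCOutput
    rw [← hγsq]
    exact TaskQuant.isAdditiveWhite_ditheredOutput hM0 hγ
      (TaskQuant.measurable_stack hsource.measurable_y N)
      (TaskQuant.measurable_stack hsource.measurable_g N)
      (fun a => hsource.memLp_y a.2 a.1) (fun b => hsource.memLp_g b.2 b.1) A hz hin hpow
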